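/- Let $(W_t)_{t\ge 0}$ be a Wiener process on a probability space $(\Omega,\mathcal F,\mathbb P)$ (standard, $W_0=0$ and continuous paths almost surely), and put $M_t=\sup_{0\le s\le t}W_s$, $m_t=\inf_{0\le s\le t}W_s$. Let $\Phi$ be the distribution function of $N(0,1)$, $\Phi^{-1}$ its inverse on $(0,1)$, and $$\Psi(q,r,s)=\sum_{k=0}^{\infty}\bigl(\Phi(q-ks)-\Phi(q-r-ks)\bigr).$$ A copula of $(W_t,M_t,m_t)$ is a function $C:[0,1]^3\to[0,1]$ that vanishes when some coordinate is $0$, equals the $j$-th coordinate when all the other coordinates are $1$, assigns non-negative volume to every rectangle, and satisfies $$\mathbb P(W_t\le x,\,M_t\le y,\,m_t\le z)=C\bigl(\mathbb P(W_t\le x),\mathbb P(M_t\le y),\mathbb P(m_t\le z)\bigr)\qquad\text{for all }x,y,z\in\mathbb R.$$ Then for every $t>0$ the triple $(W_t,M_t,m_t)$ has exactly one copula, and this copula $C_{W,M,m}$ does not depend on $t$. For all $u\in(0,1]$, $v\in[0,1)$, $w\in(0,1]$, with $$r=2\Phi^{-1}\bigl(\tfrac{1+v}{2}\bigr),\qquad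 s=2\bigl(\Phi^{-1}\bigl(\tfrac{1+v}{2}\bigr)-\Phi^{-1}\bigl(\tfrac{w}{2}\bigr)\bigr),$$ the series $\Psi(q,r,s)$ converges for every real $q$, and $$C_{W,M,m}(u,v,w)=\begin{cases}u-\Phi\bigl(\Phi^{-1}(u)-r\bigr), & 2u\le w,\\[2pt] 2\Psi\bigl(\Phi^{-1}(\tfrac w2),r,s\bigr)-\Psi\bigl(\Phi^{-1}(u)-s,r,s\bigr)-\Psi\bigl(-\Phi^{-1}(u)-s+r,r,s\bigr), & w<2u\le 1+v,\\[2pt] 2\Psi\bigl(\Phi^{-1}(\tfrac w2),r,s\bigr)-2\Psi\bigl(2\Phi^{-1}(\tfrac w2)-\Phi^{-1}(\tfrac{1+v}{2}),r,s\bigr), & 1+v<2u.\end{cases}$$ At every point of the closed cube $[0,1]^3$ the value of $C_{W,M,m}$ is the limit of this expression as its arguments tend to that point from within $(0,1)^3$. Moreover, for all $t>0$ and $u,v,w\in(0,1)$, $$C_{W,M,m}(u,v,w)=\mathbb P\bigl(W_t\le F_{W_t}^{\leftarrow}(u),\,M_t\le F_{M_t}^{\leftarrow}(v),\,m_t\le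 F_{m_t}^{\leftarrow}(w)\bigr),$$ where $F_Y^{\leftarrow}(p)=\inf\{x\in\mathbb R:\ p\le\mathbb P(Y\le x)\}$ is the quantile function of $Y$. -/

import Mathlib

open MeasureTheory ProbabilityTheory Set Filter Topology
open scoped NNReal unitInterval

/-- The running maximum `sup_{0 ≤ s ≤ t} X_s`. -/
noncomputable def runningMax {Ω : Type*} (X : ℝ≥0 → Ω → ℝ) (t : ℝ≥0) (ω : Ω) : ℝ :=
  sSup ((fun s => X s ω) '' Icc 0 t)

/-- The running minimum `inf_{0 ≤ s ≤ t} X_s`. -/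
noncomputable def runningMin {Ω : Type*} (X : ℝ≥0 → Ω → ℝ) (t : ℝ≥0) (ω : Ω) : ℝ :=
  sInf ((fun s => X s ω) '' Icc 0 t)

/-- The triple `(X_t, M_t, m_t)`. -/
noncomputable def tripleAt {Ω : Type*} (X : ℝ≥0 → Ω → ℝ) (t : ℝ≥0) : Fin 3 → Ω → ℝ :=
  ![X t, runningMax X t, runningMin X t]

/-- The generalized inverse (quantile function) `p ↦ inf {x | p ≤ F x}` of `F`. -/
noncomputable def genInverse (F : ℝ → ℝ) (p : ℝ) : ℝ :=
  sInf {x : ℝ | p ≤ F x}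

/-- The distribution function `Φ` of the standard normal law. -/
noncomputable def stdNormalCDF (x : ℝ) : ℝ :=
  cdf (gaussianReal 0 1) x

/-- `Φ⁻¹`; it is the inverse of `Φ` on `(0, 1)`. -/
noncomputable def stdNormalInv (p : ℝ) : ℝ :=
  genInverse stdNormalCDF p

/-- The general term of the series `Ψ(q, r, s)`. -/
noncomputable def psiTerm (q r s : ℝ) (k : ℕ) : ℝ :=
  stdNormalCDF (q - k * s) - stdNormalCDF (q - r - k * s)

/-- `Ψ(q, r, s) = ∑_{k ≥ 0} (Φ(q - k s) - Φ(q - r - k s))`. -/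
noncomputable def psiSeries (q r s : ℝ) : ℝ :=
  ∑' k : ℕ, psiTerm q r s k

/-- `r = 2 Φ⁻¹((1 + v) / 2)`. -/
noncomputable def paramR (v : ℝ) : ℝ :=
  2 * stdNormalInv ((1 + v) / 2)

/-- `s = 2 (Φ⁻¹((1 + v) / 2) - Φ⁻¹(w / 2))`. -/
noncomputable def paramS (v w : ℝ) : ℝ :=
  2 * (stdNormalInv ((1 + v) / 2) - stdNormalInv (w / 2))

/-- The explicit piecewise expression, on the regions `2u ≤ w`, `w < 2u ≤ 1 + v` and
`1 + v < 2u`. -/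
noncomputable def copulaFormula (u v w : ℝ) : ℝ :=
  if 2 * u ≤ w then
    u - stdNormalCDF (stdNormalInv u - paramR v)
  else if 2 * u ≤ 1 + v then
    2 * psiSeries (stdNormalInv (w / 2)) (paramR v) (paramS v w)
      - psiSeries (stdNormalInv u - paramS v w) (paramR v) (paramS v w)
      - psiSeries (-stdNormalInv u - paramS v w + paramR v) (paramR v) (paramS v w)
  else
    2 * psiSeries (stdNormalInv (w / 2)) (paramR v) (paramS v w)
      - 2 * psiSeries (2 * stdNormalInv (w / 2) - stdNormalInv ((1 + v) / 2))
          (paramR v) (paramS v w)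

/-- The signed sum of the values of `C` at the vertices of the rectangle `[a, b]`; the vertex
indexed by `S` has the coordinates of `b` in `S` and those of `a` outside `S`. -/
noncomputable def copulaVolume {n : ℕ} (C : (Fin n → I) → I) (a b : Fin n → I) : ℝ :=
  ∑ S : Finset (Fin n), (-1 : ℝ) ^ Sᶜ.card * (C (fun i => if i ∈ S then b i else a i) : ℝ)

/-- `n`-dimensional copulas. -/
structure IsCopula {n : ℕ} (C : (Fin n → I) → I) : Prop where
  grounded : ∀ a : Fin n → I, (∃ i, a i = 0) → C a = 0
  margin : ∀ (j : Fin n) (a : Fin n → I), (∀ i, i ≠ j → a i = 1) → C a = a j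
  increasing : ∀ a b : Fin n → I, a ≤ b → 0 ≤ copulaVolume C a b

/-- The joint distribution function of the random vector `X`. -/
noncomputable def jointCDF {Ω : Type*} [MeasurableSpace Ω] (P : Measure Ω) {n : ℕ}
    (X : Fin n → Ω → ℝ) (x : Fin n → ℝ) : ℝ :=
  P.real {ω | ∀ i, X i ω ≤ x i}

/-- The distribution function of a real random variable, as a number in `[0, 1]`. -/
noncomputable def marginCDF {Ω : Type*} [MeasurableSpace Ω] (P : Measure Ω)
    [IsProbabilityMeasure P] (Y : Ω → ℝ) (x : ℝ) : I :=
  ⟨P.real {ω | Y ω ≤ x}, measureReal_nonneg, measureReal_le_one⟩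

/-- The quantile function of a real random variable. -/
noncomputable def quantileFn {Ω : Type*} [MeasurableSpace Ω] (P : Measure Ω)
    [IsProbabilityMeasure P] (Y : Ω → ℝ) (p : ℝ) : ℝ :=
  genInverse (fun x => (marginCDF P Y x : ℝ)) p

/-- `C` is a copula of the random vector `X`: its joint distribution function is the composition
of `C` with the univariate margins. -/
def IsCopulaOf {Ω : Type*} [MeasurableSpace Ω] (P : Measure Ω) [IsProbabilityMeasure P] {n : ℕ}
    (X : Fin n → Ω → ℝ) (C : (Fin n → I) → I) : Prop :=
  IsCopula C ∧ ∀ x : Fin n → ℝ, jointCDF P X x = C (fun i => marginCDF P (X i) (x i))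

/-! By Sklar's theorem, a random vector with continuous margins has exactly one copula, found by
evaluating its joint distribution function at marginal quantiles. So it suffices to compute the law
of `(W_t, M_t, m_t)` at points `√t x, √t y, √t z` with `z ≤ 0 ≤ y`. The answer does not involve `t`,
and neither do the margins at these points: `Φ(x)`, `2Φ(y) - 1`, `2Φ(z)`.

The three regions are `x ≤ z`, `z < x ≤ y` and `y < x`. If `x ≤ z`, then `W_t ≤ x` already forces
`m_t ≤ z`, and the one-sided reflection principle gives `Φ(x) - Φ(x - 2y)`. If `z < x ≤ y`, subtract
from this the probability of ending in `(z, x)` while staying in `[z, y]`. If `y < x`, then `M_t ≤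
y` forces `W_t ≤ y`, so `x` may be replaced by `y`.

Both reflection arguments follow from `integral_indicator_forall_mem_eq`: if `f` is antisymmetric
about every boundary point of `D`, paths leaving `D` contribute nothing to `E f(W_t)`. It is proved
on finite grids instead of through the strong Markov property. After the first grid time outside `D`
the increment is symmetric and independent of the past, so reflecting it changes no expectation; the
overshoot across the boundary vanishes with the mesh. For an interval, `f` is the indicator of a
periodic union of intervals minus that of its mirror image, which yields a series over `ℤ`.
`measureReal_mem_Ioo_and_forall_mem_Icc` folds this series into values of `Ψ`.

Existence and uniqueness are `exists_isCopulaOf` and `IsCopulaOf.unique`. Copulas are Lipschitz, so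
agreement in the open cube is agreement everywhere; this also gives independence of `t`, the face `u
= 1` and the limits at the boundary. -/

/-! ### First exits of discrete sequences -/

/-- The sequences that leave `D` for the first time at the index `k`. -/
def firstExit (D : Set ℝ) (k : ℕ) : Set (ℕ → ℝ) := {y | (∀ i < k, y i ∈ D) ∧ y k ∉ D}

lemma measurableSet_firstExit {D : Set ℝ} (hD : MeasurableSet D) (k : ℕ) :
    MeasurableSet (firstExit D k) := by
  have : firstExit D k
      = (⋂ i, ⋂ (_ : i < k), (fun y : ℕ → ℝ => y i) ⁻¹' D) ∩ ((fun y : ℕ → ℝ => y k) ⁻¹' D)ᶜ := by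
    ext y; simp [firstExit]
  rw [this]
  exact (MeasurableSet.iInter fun i => MeasurableSet.iInter fun _ =>
    measurable_pi_apply i hD).inter (measurable_pi_apply k hD).compl

/-- The events `firstExit D j` are disjoint, so a sum over them selects the single term of the
actual exit index. -/
lemma exists_sum_indicator_firstExit {D : Set ℝ} {K : ℕ} {y : ℕ → ℝ} (h : ∃ k < K, y k ∉ D) :
    ∃ k < K, y ∈ firstExit D k ∧ ∀ c : ℕ → ℝ,
      ∑ j ∈ Finset.range K, (firstExit D j).indicator (fun _ => c j) y = c k := by
  classical
  obtain ⟨k, ⟨hkK, hk⟩, hmin⟩ : ∃ k, (k < K ∧ y k ∉ D) ∧ ∀ i < k, ¬ (i < K ∧ y i ∉ D) :=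
    ⟨Nat.find h, Nat.find_spec h, fun i hi => Nat.find_min h hi⟩
  have hin : ∀ i < k, y i ∈ D := fun i hi => by
    by_contra hc
    exact hmin i hi ⟨hi.trans hkK, hc⟩
  refine ⟨k, hkK, ⟨hin, hk⟩, fun c => ?_⟩
  rw [Finset.sum_eq_single k]
  · exact indicator_of_mem (show y ∈ firstExit D k from ⟨hin, hk⟩) _
  · intro j _ hjk
    refine indicator_of_notMem (fun hj => ?_) _
    rcases lt_or_gt_of_ne hjk with h1 | h1
    · exact hj.2 (hin j h1)
    · exact hk (hj.1 k h1)
  · simp [hkK]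

lemma sum_indicator_firstExit_eq_zero {D : Set ℝ} {K : ℕ} {y : ℕ → ℝ} (h : ∀ k < K, y k ∈ D)
    (c : ℕ → ℝ) : ∑ j ∈ Finset.range K, (firstExit D j).indicator (fun _ => c j) y = 0 :=
  Finset.sum_eq_zero fun j hj => indicator_of_notMem
    (fun h' => h'.2 (h j (Finset.mem_range.1 hj))) _

/-! ### Grid approximation of continuous paths -/

/-- The equidistant grid on `[0, t]`. -/
noncomputable def gridPt (t : ℝ≥0) (n i : ℕ) : ℝ≥0 := t * (i / (n + 1))

lemma gridPt_monotone (t : ℝ≥0) (n : ℕ) : Monotone (gridPt t n) := fun i j hij => by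
  unfold gridPt; gcongr

lemma gridPt_le {t : ℝ≥0} {n i : ℕ} (hi : i < n + 2) : gridPt t n i ≤ t := by
  unfold gridPt
  refine mul_le_of_le_one_right zero_le ?_
  rw [div_le_one (by positivity)]
  -- The indices `0, …, n + 1` run over the whole grid, the last one being the time `t` itself.
  exact_mod_cast Nat.lt_succ_iff.1 hi

lemma dist_gridPt_succ (t : ℝ≥0) (n i : ℕ) :
    dist (gridPt t n (i + 1)) (gridPt t n i) = t * (1 / ((n : ℝ) + 1)) := by
  rw [NNReal.dist_eq]
  simp only [gridPt]
  push_cast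
  rw [← mul_sub, ← sub_div, add_sub_cancel_left, abs_of_nonneg (by positivity)]

/-- The complement of `D` is open, so the path is still outside `D` at times close to `s`, and the
grid points with index `⌊(s / t)(n + 1)⌋` converge to `s`. -/
lemma eventually_exists_gridPt_notMem {w : ℝ≥0 → ℝ} (hw : Continuous w) {D : Set ℝ}
    (hD : IsClosed D) {t : ℝ≥0} (h : ∃ s ≤ t, w s ∉ D) :
    ∀ᶠ n in atTop, ∃ k < n + 2, w (gridPt t n k) ∉ D := by
  obtain ⟨s, hst, hs⟩ := h
  rcases eq_or_ne t 0 with rfl | ht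
  · refine Eventually.of_forall fun n => ⟨0, by omega, ?_⟩
    have : s = 0 := le_antisymm hst zero_le
    simpa [gridPt, this] using hs
  have ht' : (t : ℝ) ≠ 0 := by exact_mod_cast ht
  have h1 : Tendsto (fun n : ℕ => gridPt t n ⌊(s / t : ℝ) * (n + 1)⌋₊) atTop (𝓝 s) := by
    have h2 : Tendsto (fun n : ℕ => ((n : ℝ) + 1)) atTop atTop :=
      tendsto_atTop_add_const_right _ _ tendsto_natCast_atTop_atTop
    have h3 := (tendsto_nat_floor_mul_div_atTop (a := (s / t : ℝ)) (by positivity)).comp h2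
    have h4 := h3.const_mul (t : ℝ)
    rw [mul_div_cancel₀ _ ht'] at h4
    rw [← NNReal.tendsto_coe]
    refine h4.congr fun n => ?_
    simp [gridPt]
  have h2 := (hw.tendsto s).comp h1
  filter_upwards [h2 (hD.isOpen_compl.mem_nhds hs)] with n hn
  refine ⟨_, ?_, hn⟩
  have : ⌊(s / t : ℝ) * (n + 1)⌋₊ ≤ n + 1 := by
    apply Nat.floor_le_of_le
    push_cast
    exact mul_le_of_le_one_left (by positivity) (div_le_one_of_le₀ hst t.2)
  omega

/-- Bounds the overshoot: a step from inside `D` to outside crosses the boundary, so the exit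
position is within one step of a boundary point. A segment missing the frontier would be split by
the interior and the exterior of `D`, against connectedness. -/
lemma exists_frontier_abs_sub_le {D : Set ℝ} {a b : ℝ} (ha : a ∈ D) (hb : b ∉ D) :
    ∃ c ∈ frontier D, |b - c| ≤ |b - a| := by
  obtain ⟨c, hc, hcD⟩ : (uIcc a b ∩ frontier D).Nonempty := by
    by_contra hne
    have hcov : uIcc a b ⊆ interior D ∪ (closure D)ᶜ := fun x hx => by
      by_contra hx'
      rw [mem_union, not_or, notMem_compl_iff] at hx'
      exact hne ⟨x, hx, hx'.2, hx'.1⟩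
    obtain ⟨x, -, hx1, hx2⟩ := isPreconnected_uIcc _ _ isOpen_interior isClosed_closure.isOpen_compl
      hcov ⟨a, left_mem_uIcc, (hcov left_mem_uIcc).resolve_right fun h => h (subset_closure ha)⟩
      ⟨b, right_mem_uIcc, (hcov right_mem_uIcc).resolve_left fun h => hb (interior_subset h)⟩
    exact hx2 (subset_closure (interior_subset hx1))
  refine ⟨c, hcD, ?_⟩
  have := abs_sub_right_of_mem_uIcc hc
  exact this

/-! ### The reflection principle -/

section
variable {Ω : Type*} [MeasurableSpace Ω] {P : Measure Ω} {W : ℝ≥0 → Ω → ℝ}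

/-- The Markov property at a fixed time and the symmetry of the Gaussian increment. The index `min i
k` freezes the sequence at `k`, so that it depends on the past of `g k` only. -/
lemma identDistrib_past_increment_neg (hW : IsPreBrownianReal W P) {g : ℕ → ℝ≥0}
    (hg : Monotone g) (k : ℕ) {t : ℝ≥0} (hk : g k ≤ t) :
    IdentDistrib (fun ω => ((fun i => W (g (min i k)) ω : ℕ → ℝ), W t ω - W (g k) ω))
      (fun ω => ((fun i => W (g (min i k)) ω : ℕ → ℝ), -(W t ω - W (g k) ω))) P P := by
  have : IsProbabilityMeasure P := hW.isGaussianProcess.isProbabilityMeasure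
  have hind : IndepFun (fun ω => (fun i => W (g (min i k)) ω : ℕ → ℝ))
      (fun ω => W t ω - W (g k) ω) P := by
    have h := (hW.indepFun_shift (g k)).symm.comp
      (φ := fun (p : Iic (g k) → ℝ) (i : ℕ) => p ⟨g (min i k), hg (min_le_right i k)⟩)
      (ψ := fun q : ℝ≥0 → ℝ => q (t - g k)) (by fun_prop)
      (measurable_pi_apply (X := fun _ : ℝ≥0 => ℝ) (t - g k))
    simpa [Function.comp_def, add_tsub_cancel_of_le hk] using h
  have hm : AEMeasurable (fun ω => (fun i => W (g (min i k)) ω : ℕ → ℝ)) P :=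
    aemeasurable_pi_lambda _ fun i => hW.aemeasurable _
  have hl := hW.hasLaw_sub t (g k)
  have hl' := gaussianReal_neg hl
  rw [neg_zero] at hl'
  exact (IdentDistrib.refl hm).prodMk
    ⟨hl.aemeasurable, hl'.aemeasurable, hl.map_eq.trans hl'.map_eq.symm⟩ hind
    (hind.comp measurable_id measurable_neg)

lemma integral_firstExit_reflect (hW : IsPreBrownianReal W P) {D : Set ℝ} (hD : MeasurableSet D)
    {f : ℝ → ℝ} (hf : Measurable f) {g : ℕ → ℝ≥0} (hg : Monotone g) {k : ℕ} {t : ℝ≥0}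
    (hk : g k ≤ t) :
    ∫ ω, (firstExit D k).indicator (fun _ => f (W t ω)) (fun i => W (g i) ω) ∂P
      = ∫ ω, (firstExit D k).indicator (fun _ => f (2 * W (g k) ω - W t ω))
          (fun i => W (g i) ω) ∂P := by
  have hu : Measurable (fun p : (ℕ → ℝ) × ℝ =>
      (Prod.fst ⁻¹' firstExit D k).indicator (fun p => f (p.1 k + p.2)) p) :=
    Measurable.indicator (by fun_prop) (measurable_fst (measurableSet_firstExit hD k))
  have h := ((identDistrib_past_increment_neg hW hg k hk).comp hu).integral_eq
  -- Whether the first exit occurs at `k` is decided by the coordinates up to `k`, which freezing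
  -- leaves unchanged.
  have hmem : ∀ ω, (fun i => W (g (min i k)) ω) ∈ firstExit D k ↔
      (fun i => W (g i) ω) ∈ firstExit D k := fun ω => by
    simp only [firstExit, mem_ofPred_eq, min_self]
    refine and_congr_left fun _ => forall₂_congr fun i hi => ?_
    rw [min_eq_left hi.le]
  have e : ∀ (ω : Ω) (x : ℝ), (Prod.fst ⁻¹' firstExit D k).indicator
      (fun p : (ℕ → ℝ) × ℝ => f (p.1 k + p.2)) (fun i => W (g (min i k)) ω, x)
      = (firstExit D k).indicator (fun _ => f (W (g k) ω + x)) (fun i => W (g i) ω) := fun ω x => by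
    by_cases hω : (fun i => W (g i) ω) ∈ firstExit D k
    · rw [indicator_of_mem hω, indicator_of_mem (by exact (hmem ω).2 hω)]
      simp only [min_self]
    · rw [indicator_of_notMem hω, indicator_of_notMem (by exact mt (hmem ω).1 hω)]
  have e' : ∀ a b : ℝ, a + -(b - a) = 2 * a - b := fun a b => by ring
  simpa only [Function.comp_def, e, e', add_sub_cancel] using h

lemma aestronglyMeasurable_firstExit_indicator (hW : IsPreBrownianReal W P) {D : Set ℝ}
    (hD : MeasurableSet D) {F : ℝ → ℝ → ℝ} (hF : Measurable (Function.uncurry F)) (g : ℕ → ℝ≥0)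
    (k : ℕ) (t : ℝ≥0) :
    AEStronglyMeasurable (fun ω => (firstExit D k).indicator
      (fun _ => F (W (g k) ω) (W t ω)) (fun i => W (g i) ω)) P := by
  have hu : Measurable (fun p : (ℕ → ℝ) × ℝ =>
      (Prod.fst ⁻¹' firstExit D k).indicator (fun p => F (p.1 k) p.2) p) :=
    Measurable.indicator (hF.comp (by fun_prop : Measurable fun p : (ℕ → ℝ) × ℝ => (p.1 k, p.2)))
      (measurable_fst (measurableSet_firstExit hD k))
  have hm : AEMeasurable (fun ω => ((fun i => W (g i) ω : ℕ → ℝ), W t ω)) P :=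
    (aemeasurable_pi_lambda _ fun i => hW.aemeasurable _).prodMk (hW.aemeasurable t)
  exact (hu.comp_aemeasurable hm).aestronglyMeasurable

/-- For continuous paths and closed `D` the uncountably many conditions reduce to those at the
countably many grid points. -/
lemma nullMeasurableSet_forall_mem (hW : IsBrownianReal W P) {D : Set ℝ} (hD : IsClosed D)
    (t : ℝ≥0) : NullMeasurableSet {ω | ∀ s ≤ t, W s ω ∈ D} P := by
  have h : NullMeasurableSet (⋂ n, ⋂ k, ⋂ (_ : k < n + 2), W (gridPt t n k) ⁻¹' D) P :=
    NullMeasurableSet.iInter fun n => NullMeasurableSet.iInter fun k =>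
      NullMeasurableSet.iInter fun _ => (hW.aemeasurable _).nullMeasurable hD.measurableSet
  refine h.congr ?_
  filter_upwards [hW.cont] with ω hω
  refine propext ⟨fun h s hs => ?_, fun h => ?_⟩
  · by_contra hc
    obtain ⟨n, k, hk, hn⟩ := (eventually_exists_gridPt_notMem hω hD ⟨s, hs, hc⟩).exists
    exact hn (mem_iInter.1 (mem_iInter₂.1 h n k) hk)
  · exact mem_iInter₂.2 fun n k => mem_iInter.2 fun hk => h _ (gridPt_le hk)

/-- The path-wise error in the reflection at the first exit from `D` along a grid vanishes. -/
lemma tendsto_firstExit_reflect_add {w : ℝ≥0 → ℝ} (hw : Continuous w) {D : Set ℝ}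
    (h0 : w 0 ∈ D) {f : ℝ → ℝ} (hanti : ∀ b ∈ frontier D, ∀ x, f (2 * b - x) = -f x) {t : ℝ≥0}
    (hf : ContinuousAt f (w t)) :
    Tendsto (fun n => ∑ k ∈ Finset.range (n + 2), (firstExit D k).indicator
      (fun _ => f (w t) + f (2 * w (gridPt t n k) - w t)) (fun i => w (gridPt t n i)))
      atTop (𝓝 0) := by
  rw [Metric.tendsto_atTop]
  intro ε hε
  obtain ⟨δ, hδ, hfδ⟩ := Metric.continuousAt_iff.1 hf ε hε
  have hu : UniformContinuousOn w (Icc 0 t) :=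
    isCompact_Icc.uniformContinuousOn_of_continuous hw.continuousOn
  obtain ⟨η, hη, hwη⟩ := Metric.uniformContinuousOn_iff.1 hu (δ / 2) (half_pos hδ)
  have hlim : Tendsto (fun n : ℕ => (t : ℝ) * (1 / ((n : ℝ) + 1))) atTop (𝓝 0) := by
    simpa using tendsto_one_div_add_atTop_nhds_zero_nat.const_mul (t : ℝ)
  obtain ⟨N, hN⟩ := eventually_atTop.1 (hlim.eventually_lt_const hη)
  refine ⟨N, fun n hn => ?_⟩
  by_cases hex : ∃ k < n + 2, w (gridPt t n k) ∉ D
  · obtain ⟨k, hk, hmem, hsum⟩ := exists_sum_indicator_firstExit (y := fun i => w (gridPt t n i)) hex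
    rw [hsum fun k => f (w t) + f (2 * w (gridPt t n k) - w t)]
    -- The path starts in `D`, so the exit index is positive and the preceding grid point lies in
    -- `D`.
    obtain ⟨j, rfl⟩ : ∃ j, k = j + 1 := by
      refine Nat.exists_eq_succ_of_ne_zero ?_
      rintro rfl
      exact hmem.2 (by simpa [gridPt] using h0)
    obtain ⟨c, hc, hcb⟩ := exists_frontier_abs_sub_le (hmem.1 j (Nat.lt_succ_self j)) hmem.2
    have h1 : |w (gridPt t n (j + 1)) - w (gridPt t n j)| < δ / 2 := by
      rw [← Real.dist_eq]
      refine hwη _ ⟨zero_le, gridPt_le hk⟩ _ ⟨zero_le, gridPt_le (by omega)⟩ ?_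
      rw [dist_gridPt_succ]
      exact hN n hn
    -- Reflecting at the boundary point `c` instead of the exit position shifts the argument by
    -- twice the overshoot; hence the modulus `δ / 2` above.
    have h2 : f (2 * w (gridPt t n (j + 1)) - w t)
        = -f (w t - 2 * (w (gridPt t n (j + 1)) - c)) := by
      rw [← hanti c hc]
      ring_nf
    have h3 : dist (w t - 2 * (w (gridPt t n (j + 1)) - c)) (w t) < δ := by
      rw [Real.dist_eq, sub_sub_cancel_left, abs_neg, abs_mul, abs_two]
      linarith
    have h4 := hfδ h3
    rw [Real.dist_eq, abs_sub_comm] at h4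
    rwa [h2, Real.dist_eq, sub_zero, ← sub_eq_add_neg]
  · push Not at hex
    rw [sum_indicator_firstExit_eq_zero hex fun k => f (w t) + f (2 * w (gridPt t n k) - w t)]
    simpa using hε

lemma abs_sum_indicator_firstExit_le {D : Set ℝ} {K : ℕ} {y c : ℕ → ℝ} {B : ℝ} (hB : 0 ≤ B)
    (hc : ∀ k, |c k| ≤ B) :
    |∑ j ∈ Finset.range K, (firstExit D j).indicator (fun _ => c j) y| ≤ B := by
  by_cases hex : ∃ k < K, y k ∉ D
  · obtain ⟨k, -, -, hsum⟩ := exists_sum_indicator_firstExit hex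
    rw [hsum]
    exact hc k
  · push Not at hex
    rwa [sum_indicator_firstExit_eq_zero hex, abs_zero]

/-- **Reflection principle.** If `f` is antisymmetric about the boundary points of `D`, then the
paths that leave `D` before time `t` do not contribute to the expectation of `f (W t)`. -/
theorem integral_indicator_forall_mem_eq (hW : IsBrownianReal W P) {D : Set ℝ} (hD : IsClosed D)
    (h0 : (0 : ℝ) ∈ D) {f : ℝ → ℝ} (hf : Measurable f) {B : ℝ} (hB : ∀ x, |f x| ≤ B)
    (hanti : ∀ b ∈ frontier D, ∀ x, f (2 * b - x) = -f x) {t : ℝ≥0}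
    (hc : ∀ᵐ x ∂gaussianReal 0 t, ContinuousAt f x) :
    ∫ ω, {ω | ∀ s ≤ t, W s ω ∈ D}.indicator (fun ω => f (W t ω)) ω ∂P
      = ∫ x, f x ∂gaussianReal 0 t := by
  have : IsProbabilityMeasure P := hW.isGaussianProcess.isProbabilityMeasure
  have hB0 : 0 ≤ B := (abs_nonneg _).trans (hB 0)
  set E : Set Ω := {ω | ∀ s ≤ t, W s ω ∈ D} with hE
  have hEm : NullMeasurableSet E P := nullMeasurableSet_forall_mem hW hD t
  have hlaw := hW.hasLaw_eval t
  have hfW : AEStronglyMeasurable (fun ω => f (W t ω)) P :=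
    (hf.comp_aemeasurable (hW.aemeasurable t)).aestronglyMeasurable
  have hint : Integrable (fun ω => f (W t ω)) P :=
    Integrable.of_bound hfW B (ae_of_all _ fun ω => by simpa using hB _)
  have hc' : ∀ᵐ ω ∂P, ContinuousAt f (W t ω) := by
    rw [← hlaw.map_eq] at hc
    exact ae_of_ae_map hlaw.aemeasurable hc
  -- `J n` is `f (W t)` on the paths seen to leave `D` along the grid; `H n` adds its reflected
  -- version, so it is a pure error term.
  let J : ℕ → Ω → ℝ := fun n ω => ∑ k ∈ Finset.range (n + 2), (firstExit D k).indicator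
      (fun _ => f (W t ω)) (fun i => W (gridPt t n i) ω)
  let H : ℕ → Ω → ℝ := fun n ω => ∑ k ∈ Finset.range (n + 2), (firstExit D k).indicator
      (fun _ => f (W t ω) + f (2 * W (gridPt t n k) ω - W t ω)) (fun i => W (gridPt t n i) ω)
  have hm1 : ∀ n k, AEStronglyMeasurable (fun ω => (firstExit D k).indicator
      (fun _ => f (W t ω)) (fun i => W (gridPt t n i) ω)) P := fun n k =>
    aestronglyMeasurable_firstExit_indicator hW.toIsPreBrownianReal hD.measurableSet
      (F := fun _ x => f x) (hf.comp measurable_snd) _ _ _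
  have hm2 : ∀ n k, AEStronglyMeasurable (fun ω => (firstExit D k).indicator
      (fun _ => f (2 * W (gridPt t n k) ω - W t ω)) (fun i => W (gridPt t n i) ω)) P := fun n k =>
    aestronglyMeasurable_firstExit_indicator hW.toIsPreBrownianReal hD.measurableSet
      (F := fun y x => f (2 * y - x)) (hf.comp (by fun_prop)) _ _ _
  have hi1 : ∀ n k, Integrable (fun ω => (firstExit D k).indicator
      (fun _ => f (W t ω)) (fun i => W (gridPt t n i) ω)) P := fun n k =>
    Integrable.of_bound (hm1 n k) B (ae_of_all _ fun ω => by
      refine (norm_indicator_le_norm_self _ _).trans (hB _))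
  have hi2 : ∀ n k, Integrable (fun ω => (firstExit D k).indicator
      (fun _ => f (2 * W (gridPt t n k) ω - W t ω)) (fun i => W (gridPt t n i) ω)) P := fun n k =>
    Integrable.of_bound (hm2 n k) B (ae_of_all _ fun ω => by
      refine (norm_indicator_le_norm_self _ _).trans (hB _))
  have hHsplit : ∀ n ω, H n ω = J n ω + ∑ k ∈ Finset.range (n + 2), (firstExit D k).indicator
      (fun _ => f (2 * W (gridPt t n k) ω - W t ω)) (fun i => W (gridPt t n i) ω) := fun n ω => by
    simp only [H, J]
    rw [← Finset.sum_add_distrib]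
    refine Finset.sum_congr rfl fun k _ => ?_
    exact congrFun (indicator_add (firstExit D k) (fun _ => f (W t ω)) fun _ =>
      f (2 * W (gridPt t n k) ω - W t ω)) _
  have hJi : ∀ n, Integrable (J n) P := fun n => integrable_finsetSum _ fun k _ => hi1 n k
  -- Reflection at each first exit leaves the expectation unchanged, so the two halves of `H n` have
  -- equal integrals.
  have hint2 : ∀ n, ∫ ω, H n ω ∂P = 2 * ∫ ω, J n ω ∂P := fun n => by
    simp_rw [hHsplit]
    rw [integral_add (hJi n) (integrable_finsetSum _ fun k _ => hi2 n k),
      integral_finsetSum _ (fun k _ => hi2 n k), two_mul]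
    congr 1
    rw [integral_finsetSum _ (fun k _ => hi1 n k)]
    refine Finset.sum_congr rfl fun k hk => ?_
    exact (integral_firstExit_reflect hW.toIsPreBrownianReal hD.measurableSet hf
      (gridPt_monotone t n) (gridPt_le (Finset.mem_range.1 hk))).symm
  have hHlim : Tendsto (fun n => ∫ ω, H n ω ∂P) atTop (𝓝 (∫ _, (0 : ℝ) ∂P)) := by
    refine tendsto_integral_of_dominated_convergence (fun _ => 2 * B) (fun n => ?_)
      (integrable_const _) (fun n => ae_of_all _ fun ω => ?_) ?_
    · simp_rw [funext (hHsplit n)]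
      exact (hJi n).aestronglyMeasurable.add
        (integrable_finsetSum _ fun k _ => hi2 n k).aestronglyMeasurable
    · refine abs_sum_indicator_firstExit_le (by linarith)
        (c := fun k => f (W t ω) + f (2 * W (gridPt t n k) ω - W t ω)) fun k => ?_
      refine (abs_add_le _ _).trans ?_
      linarith [hB (W t ω), hB (2 * W (gridPt t n k) ω - W t ω)]
    · filter_upwards [hW.cont, hW.eval_zero_ae_eq_zero, hc'] with ω h1 h2 h3
      exact tendsto_firstExit_reflect_add (w := fun s => W s ω) h1 (by simpa [h2] using h0) hanti h3
  have hJlim : Tendsto (fun n => ∫ ω, J n ω ∂P) atTop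
      (𝓝 (∫ ω, Eᶜ.indicator (fun ω => f (W t ω)) ω ∂P)) := by
    refine tendsto_integral_of_dominated_convergence (fun _ => B)
      (fun n => (hJi n).aestronglyMeasurable)
      (integrable_const _) (fun n => ae_of_all _ fun ω => ?_) ?_
    · exact abs_sum_indicator_firstExit_le hB0 (c := fun k => f (W t ω)) fun k => hB _
    · filter_upwards [hW.cont] with ω h1
      refine tendsto_const_nhds.congr' ?_
      by_cases hω : ω ∈ E
      · refine Eventually.of_forall fun n => ?_
        rw [indicator_of_notMem (by simpa using hω)]
        exact (sum_indicator_firstExit_eq_zero (fun k hk => hω _ (gridPt_le hk))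
          fun _ => f (W t ω)).symm
      · have hω' : ∃ s ≤ t, W s ω ∉ D := by
          simpa [hE] using hω
        filter_upwards [eventually_exists_gridPt_notMem h1 hD hω'] with n hn
        rw [indicator_of_mem (by simpa using hω)]
        obtain ⟨k, -, -, hsum⟩ :=
          exists_sum_indicator_firstExit (y := fun i => W (gridPt t n i) ω) hn
        exact (hsum fun _ => f (W t ω)).symm
  -- The integrals of `H n = 2 J n` (in mean) tend both to `0` and to twice the contribution of the
  -- exiting paths.
  have hzero : ∫ ω, Eᶜ.indicator (fun ω => f (W t ω)) ω ∂P = 0 := by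
    simp_rw [hint2] at hHlim
    have := tendsto_nhds_unique hHlim (hJlim.const_mul 2)
    simp only [integral_zero] at this
    linarith
  rw [← hlaw.map_eq, integral_map hlaw.aemeasurable hf.aestronglyMeasurable]
  have hsum : ∀ ω, f (W t ω) = E.indicator (fun ω => f (W t ω)) ω
      + Eᶜ.indicator (fun ω => f (W t ω)) ω := fun ω => by
    exact (congrFun (indicator_self_add_compl E fun ω => f (W t ω)) ω).symm
  calc _ = ∫ ω, E.indicator (fun ω => f (W t ω)) ω ∂P
        + ∫ ω, Eᶜ.indicator (fun ω => f (W t ω)) ω ∂P := by rw [hzero, add_zero]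
    _ = ∫ ω, f (W t ω) ∂P := by
      rw [← integral_add (hint.indicator₀ hEm) (hint.indicator₀ hEm.compl)]
      exact integral_congr_ae (ae_of_all _ fun ω => (hsum ω).symm)

end

/-! ### Copulas -/

lemma Finset.prod_sub_eq_sum {n : ℕ} (f g : Fin n → ℝ) :
    ∏ i, (f i - g i) = ∑ S : Finset (Fin n),
      (-1 : ℝ) ^ Sᶜ.card * ∏ i, (if i ∈ S then f i else g i) := by
  classical
  simp_rw [sub_eq_add_neg]
  rw [Finset.prod_add]
  simp only [Finset.powerset_univ, ← Finset.compl_eq_univ_sdiff]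
  refine Finset.sum_congr rfl fun S _ => ?_
  rw [Finset.prod_ite, Finset.prod_neg]
  have h1 : Finset.univ.filter (fun i => i ∈ S) = S := by ext; simp
  have h2 : Finset.univ.filter (fun i => i ∉ S) = Sᶜ := by ext; simp
  rw [h1, h2]
  ring

section
variable {Ω : Type*} [MeasurableSpace Ω] {P : Measure Ω} [IsProbabilityMeasure P]

lemma measureReal_forall_eq_integral_prod {n : ℕ} {Y : Fin n → Ω → ℝ}
    (hY : ∀ i, AEMeasurable (Y i) P) (c : Fin n → ℝ) :
    Integrable (fun ω => ∏ i, (if Y i ω ≤ c i then (1 : ℝ) else 0)) P ∧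
    P.real {ω | ∀ i, Y i ω ≤ c i} = ∫ ω, ∏ i, (if Y i ω ≤ c i then (1 : ℝ) else 0) ∂P := by
  classical
  have hm : NullMeasurableSet {ω | ∀ i, Y i ω ≤ c i} P := by
    rw [ofPred_forall]
    exact NullMeasurableSet.iInter fun i => (hY i).nullMeasurable measurableSet_Iic
  have he : (fun ω => ∏ i, (if Y i ω ≤ c i then (1 : ℝ) else 0))
      = {ω | ∀ i, Y i ω ≤ c i}.indicator 1 := by
    ext ω
    rw [Finset.prod_ite_zero]
    simp [indicator]
  rw [he]
  refine ⟨(integrable_const (1 : ℝ)).indicator₀ hm, ?_⟩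
  rw [integral_indicator₀ hm]
  simp

/-- Inclusion–exclusion: the signed sum is the expectation of `∏ i, (1_{Y i ≤ b i} - 1_{Y i ≤ a
i})`, whose factors are non-negative. -/
lemma volume_jointCDF_nonneg {n : ℕ} {Y : Fin n → Ω → ℝ}
    (hY : ∀ i, AEMeasurable (Y i) P) {a b : Fin n → ℝ} (hab : a ≤ b) :
    0 ≤ ∑ S : Finset (Fin n), (-1 : ℝ) ^ Sᶜ.card *
      P.real {ω | ∀ i, Y i ω ≤ (if i ∈ S then b i else a i)} := by
  have h := fun c => measureReal_forall_eq_integral_prod hY c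
  simp_rw [fun c => (h c).2, ← integral_const_mul]
  rw [← integral_finsetSum _ fun S _ => (h _).1.const_mul _]
  refine integral_nonneg fun ω => ?_
  have := Finset.prod_sub_eq_sum (fun i => if Y i ω ≤ b i then (1 : ℝ) else 0)
    (fun i => if Y i ω ≤ a i then (1 : ℝ) else 0)
  calc (0 : ℝ) ≤ ∏ i, ((if Y i ω ≤ b i then (1 : ℝ) else 0) - if Y i ω ≤ a i then (1 : ℝ) else 0) := by
        refine Finset.prod_nonneg fun i _ => ?_
        have := hab i
        split_ifs with h1 h2 h2
        · norm_num
        · norm_num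
        · exact absurd (h2.trans this) h1
        · norm_num
    _ = _ := by
        rw [this]
        refine Finset.sum_congr rfl fun S _ => ?_
        congr 2 with i
        split_ifs <;> rfl

lemma marginCDF_mono (Y : Ω → ℝ) : Monotone (marginCDF P Y) := fun _ _ h =>
  Subtype.coe_le_coe.1 (measureReal_mono fun _ hω => le_trans hω h)

lemma cdf_map_eq_marginCDF {Y : Ω → ℝ} (hY : AEMeasurable Y P) (x : ℝ) :
    cdf (P.map Y) x = marginCDF P Y x := by
  have := Measure.isProbabilityMeasure_map hY
  rw [cdf_eq_real, map_measureReal_apply_of_aemeasurable hY measurableSet_Iic]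
  rfl

lemma exists_marginCDF_eq {Y : Ω → ℝ} (hY : AEMeasurable Y P) (hc : Continuous (marginCDF P Y))
    {p : I} (h0 : 0 < p) (h1 : p < 1) : ∃ x, marginCDF P Y x = p := by
  have := Measure.isProbabilityMeasure_map hY
  have hb := (tendsto_cdf_atBot (P.map Y)).congr (cdf_map_eq_marginCDF hY)
  have ht := (tendsto_cdf_atTop (P.map Y)).congr (cdf_map_eq_marginCDF hY)
  obtain ⟨a, ha⟩ := (hb.eventually_lt_const (show (0 : ℝ) < p from h0)).exists
  obtain ⟨b, hb⟩ := (ht.eventually_const_lt (show (p : ℝ) < 1 from h1)).exists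
  exact mem_range_of_exists_le_of_exists_ge hc ⟨a, le_of_lt ha⟩ ⟨b, le_of_lt hb⟩

/-- **Probability integral transform.** -/
lemma measureReal_marginCDF_le {Y : Ω → ℝ} (hY : AEMeasurable Y P)
    (hc : Continuous (marginCDF P Y)) (p : I) :
    P.real {ω | marginCDF P Y (Y ω) ≤ p} = p := by
  rcases eq_or_ne p 1 with rfl | hp1
  · have : {ω | marginCDF P Y (Y ω) ≤ 1} = univ := by
      ext ω; simpa using unitInterval.le_one'
    rw [this]; simp
  have hp1' : p < 1 := lt_of_le_of_ne unitInterval.le_one' hp1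
  apply le_antisymm
  -- The level set of `p` may be an interval, so the upper bound compares with a point `x` at a
  -- strictly higher level `q` and lets `q` decrease to `p`.
  · refine le_of_forall_gt_imp_ge_of_dense fun q hq => ?_
    rcases le_or_gt 1 q with hq1 | hq1
    · exact measureReal_le_one.trans hq1
    obtain ⟨x, hx⟩ := exists_marginCDF_eq hY hc (p := ⟨q, p.2.1.trans hq.le, hq1.le⟩)
      (show (0 : ℝ) < q from p.2.1.trans_lt hq) hq1
    have hxq : P.real {ω | Y ω ≤ x} = q := congrArg Subtype.val hx
    rw [← hxq]
    refine measureReal_mono fun ω hω => ?_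
    by_contra hlt
    have h1 : marginCDF P Y x ≤ marginCDF P Y (Y ω) := marginCDF_mono Y (le_of_lt (not_le.1 hlt))
    rw [hx] at h1
    exact absurd (h1.trans hω) (not_le.2 hq)
  · rcases eq_or_ne p 0 with rfl | hp0
    · exact measureReal_nonneg
    obtain ⟨x, hx⟩ := exists_marginCDF_eq hY hc (bot_lt_iff_ne_bot.2 hp0) hp1'
    have hxq : P.real {ω | Y ω ≤ x} = p := congrArg Subtype.val hx
    rw [← hxq]
    refine measureReal_mono fun ω hω => ?_
    exact (marginCDF_mono Y hω).trans_eq hx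

lemma aemeasurable_marginCDF_comp {Y : Ω → ℝ} (hY : AEMeasurable Y P) :
    AEMeasurable (fun ω => (marginCDF P Y (Y ω) : ℝ)) P :=
  (measurable_subtype_coe.comp (marginCDF_mono Y).measurable).comp_aemeasurable hY

/-- **Sklar's theorem**, existence part, for continuous margins. -/
theorem exists_isCopulaOf {n : ℕ} {X : Fin n → Ω → ℝ} (hX : ∀ i, AEMeasurable (X i) P)
    (hc : ∀ i, Continuous (marginCDF P (X i))) : ∃ C : (Fin n → I) → I, IsCopulaOf P X C := by
  -- The copula is the joint distribution function of the vector `F_i(X_i)`, whose margins are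
  -- uniform.
  have hU := fun i p => measureReal_marginCDF_le (hX i) (hc i) p
  refine ⟨fun a => ⟨P.real {ω | ∀ i, (marginCDF P (X i) (X i ω) : ℝ) ≤ a i}, measureReal_nonneg,
    measureReal_le_one⟩, ⟨?_, ?_, ?_⟩, ?_⟩
  · rintro a ⟨i, hi⟩
    refine Subtype.ext (le_antisymm ?_ measureReal_nonneg)
    calc _ ≤ P.real {ω | marginCDF P (X i) (X i ω) ≤ 0} :=
          measureReal_mono fun ω hω => by have := hω i; rwa [hi] at this
      _ = _ := hU i 0
  · intro j a ha
    refine Subtype.ext ?_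
    refine Eq.trans ?_ (hU j (a j))
    change P.real _ = P.real _
    congr 1
    ext ω
    refine ⟨fun h => h j, fun h i => ?_⟩
    rcases eq_or_ne i j with rfl | hij
    · exact h
    · rw [ha i hij]; exact (marginCDF P (X i) (X i ω)).2.2
  · intro a b hab
    have := volume_jointCDF_nonneg (P := P) (fun i => aemeasurable_marginCDF_comp (hX i))
      (a := fun i => (a i : ℝ)) (b := fun i => (b i : ℝ)) hab
    convert this using 1
    unfold copulaVolume
    refine Finset.sum_congr rfl fun S _ => ?_
    refine congrArg (_ * P.real ·) (Set.ext fun ω => forall_congr' fun i => ?_)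
    dsimp only
    split_ifs <;> rfl
  · intro x
    refine measureReal_congr ?_
    -- The left event lies inside the right one and both have probability `F_i(x_i)`.
    have h1 : ∀ i, {ω | X i ω ≤ x i} =ᵐ[P]
        {ω | marginCDF P (X i) (X i ω) ≤ marginCDF P (X i) (x i)} := fun i => by
      refine ae_eq_of_subset_of_measure_ge (fun ω hω => marginCDF_mono _ hω) ?_
        ((hX i).nullMeasurable measurableSet_Iic) (measure_ne_top _ _)
      rw [← ENNReal.toReal_le_toReal (measure_ne_top _ _) (measure_ne_top _ _)]
      exact (hU i _).le
    filter_upwards [ae_all_iff.2 h1] with ω hω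
    exact propext (forall_congr' fun i => iff_of_eq (hω i))

end

/-! ### Lipschitz continuity of three-dimensional copulas -/

lemma copulaVolume_three (C : (Fin 3 → I) → I) (a b : Fin 3 → I) :
    copulaVolume C a b = C ![b 0, b 1, b 2]
      - C ![a 0, b 1, b 2] - C ![b 0, a 1, b 2] - C ![b 0, b 1, a 2]
      + C ![a 0, a 1, b 2] + C ![a 0, b 1, a 2] + C ![b 0, a 1, a 2]
      - C ![a 0, a 1, a 2] := by
  have hu : (Finset.univ : Finset (Finset (Fin 3)))
      = {∅, {0}, {1}, {2}, {0, 1}, {0, 2}, {1, 2}, {0, 1, 2}} := by decide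
  have hC : ∀ S : Finset (Fin 3), C (fun i => if i ∈ S then b i else a i)
      = C ![if 0 ∈ S then b 0 else a 0, if 1 ∈ S then b 1 else a 1, if 2 ∈ S then b 2 else a 2] :=
    fun S => congrArg C (by ext i; fin_cases i <;> rfl)
  unfold copulaVolume
  simp_rw [hC, hu, Finset.card_compl, Fintype.card_fin]
  repeat rw [Finset.sum_insert (by decide)]
  rw [Finset.sum_singleton]
  simp [show ({0, 1} : Finset (Fin 3)).card = 2 from rfl,
    show ({0, 2} : Finset (Fin 3)).card = 2 from rfl,
    show ({1, 2} : Finset (Fin 3)).card = 2 from rfl,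
    show ({0, 1, 2} : Finset (Fin 3)).card = 3 from rfl]
  ring

namespace IsCopula
variable {C : (Fin 3 → I) → I}

lemma three_volume_nonneg (hC : IsCopula C) {a0 a1 a2 b0 b1 b2 : I} (h0 : a0 ≤ b0) (h1 : a1 ≤ b1)
    (h2 : a2 ≤ b2) : (0 : ℝ) ≤ C ![b0, b1, b2]
      - C ![a0, b1, b2] - C ![b0, a1, b2] - C ![b0, b1, a2]
      + C ![a0, a1, b2] + C ![a0, b1, a2] + C ![b0, a1, a2] - C ![a0, a1, a2] := by
  have := hC.increasing ![a0, a1, a2] ![b0, b1, b2] (by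
    intro i; fin_cases i <;> assumption)
  rw [copulaVolume_three] at this
  simpa using this

lemma three_zero (hC : IsCopula C) (a b : I) : (C ![0, a, b] : ℝ) = 0 ∧ (C ![a, 0, b] : ℝ) = 0 ∧
    (C ![a, b, 0] : ℝ) = 0 := by
  refine ⟨?_, ?_, ?_⟩
  · rw [hC.grounded _ ⟨0, rfl⟩]; rfl
  · rw [hC.grounded _ ⟨1, rfl⟩]; rfl
  · rw [hC.grounded _ ⟨2, rfl⟩]; rfl

lemma three_margin (hC : IsCopula C) (a : I) : (C ![a, 1, 1] : ℝ) = a ∧ (C ![1, a, 1] : ℝ) = a ∧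
    (C ![1, 1, a] : ℝ) = a := by
  refine ⟨?_, ?_, ?_⟩
  · rw [hC.margin 0 ![a, 1, 1] (by intro i hi; fin_cases i <;> simp_all)]; rfl
  · rw [hC.margin 1 ![1, a, 1] (by intro i hi; fin_cases i <;> simp_all)]; rfl
  · rw [hC.margin 2 ![1, 1, a] (by intro i hi; fin_cases i <;> simp_all)]; rfl

lemma three_lipschitz_zero (hC : IsCopula C) {a b : I} (hab : a ≤ b) (p q : I) :
    |(C ![b, p, q] : ℝ) - C ![a, p, q]| ≤ b - a := by
  have l0 : ∀ x : I, 0 ≤ x := fun x => unitInterval.nonneg'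
  have l1 : ∀ x : I, x ≤ 1 := fun x => unitInterval.le_one'
  -- The first box shows that the increment over `[a, b]` is non-negative. The next two show that it
  -- grows as `p`, then `q`, is raised to `1`, where it equals `b - a`.
  have h1 := hC.three_volume_nonneg hab (l0 p) (l0 q)
  have h2 := hC.three_volume_nonneg hab (l1 p) (l0 q)
  have h3 := hC.three_volume_nonneg hab (l0 1) (l1 q)
  simp only [hC.three_zero, hC.three_margin] at h1 h2 h3
  rw [abs_of_nonneg (by linarith)]
  linarith

lemma three_lipschitz_one (hC : IsCopula C) {a b : I} (hab : a ≤ b) (p q : I) :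
    |(C ![p, b, q] : ℝ) - C ![p, a, q]| ≤ b - a := by
  have l0 : ∀ x : I, 0 ≤ x := fun x => unitInterval.nonneg'
  have l1 : ∀ x : I, x ≤ 1 := fun x => unitInterval.le_one'
  have h1 := hC.three_volume_nonneg (l0 p) hab (l0 q)
  have h2 := hC.three_volume_nonneg (l1 p) hab (l0 q)
  have h3 := hC.three_volume_nonneg (l0 1) hab (l1 q)
  simp only [hC.three_zero, hC.three_margin] at h1 h2 h3
  rw [abs_of_nonneg (by linarith)]
  linarith

lemma three_lipschitz_two (hC : IsCopula C) {a b : I} (hab : a ≤ b) (p q : I) :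
    |(C ![p, q, b] : ℝ) - C ![p, q, a]| ≤ b - a := by
  have l0 : ∀ x : I, 0 ≤ x := fun x => unitInterval.nonneg'
  have l1 : ∀ x : I, x ≤ 1 := fun x => unitInterval.le_one'
  have h1 := hC.three_volume_nonneg (l0 p) (l0 q) hab
  have h2 := hC.three_volume_nonneg (l1 p) (l0 q) hab
  have h3 := hC.three_volume_nonneg (l0 1) (l1 q) hab
  simp only [hC.three_zero, hC.three_margin] at h1 h2 h3
  rw [abs_of_nonneg (by linarith)]
  linarith

/-- Copulas are Lipschitz. -/
lemma abs_sub_le (hC : IsCopula C) (a b : Fin 3 → I) :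
    |(C a : ℝ) - C b| ≤ |(a 0 : ℝ) - b 0| + |(a 1 : ℝ) - b 1| + |(a 2 : ℝ) - b 2| := by
  have key : ∀ {x y : I} {f : I → ℝ}, (∀ {x y : I}, x ≤ y → |f y - f x| ≤ y - x) →
      |f x - f y| ≤ |(x : ℝ) - y| := by
    intro x y f h
    rcases le_total x y with hxy | hxy
    · rw [abs_sub_comm, abs_sub_comm (x : ℝ)]
      exact (h hxy).trans (le_abs_self _)
    · exact (h hxy).trans (le_abs_self _)
  have ha : a = ![a 0, a 1, a 2] := by ext i; fin_cases i <;> rfl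
  have hb : b = ![b 0, b 1, b 2] := by ext i; fin_cases i <;> rfl
  have h0 := key (x := a 0) (y := b 0) (f := fun x => C ![x, a 1, a 2])
    fun h => hC.three_lipschitz_zero h _ _
  have h1 := key (x := a 1) (y := b 1) (f := fun x => C ![b 0, x, a 2])
    fun h => hC.three_lipschitz_one h _ _
  have h2 := key (x := a 2) (y := b 2) (f := fun x => C ![b 0, b 1, x])
    fun h => hC.three_lipschitz_two h _ _
  rw [← ha] at h0
  rw [← hb] at h2
  calc |(C a : ℝ) - C b| = |(C a - C ![b 0, a 1, a 2] : ℝ)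
        + (C ![b 0, a 1, a 2] - C ![b 0, b 1, a 2]) + (C ![b 0, b 1, a 2] - C b)| := by ring_nf
    _ ≤ _ := (abs_add_three _ _ _).trans (add_le_add_three h0 h1 h2)

lemma continuous_coe (hC : IsCopula C) : Continuous fun a => (C a : ℝ) := by
  refine continuous_iff_continuousAt.2 fun b => ?_
  rw [ContinuousAt, tendsto_iff_dist_tendsto_zero]
  refine squeeze_zero (fun _ => dist_nonneg) (fun a => hC.abs_sub_le a b) ?_
  have : Continuous fun a : Fin 3 → I =>
      |(a 0 : ℝ) - b 0| + |(a 1 : ℝ) - b 1| + |(a 2 : ℝ) - b 2| := by fun_prop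
  simpa using this.tendsto b

end IsCopula

lemma dense_open_unit_cube {n : ℕ} : Dense {a : Fin n → I | ∀ i, a i ∈ Ioo 0 1} := by
  have h : Dense (Ioo (0 : I) 1) := by
    rw [dense_iff_closure_eq, closure_Ioo (by exact zero_ne_one)]
    exact eq_univ_of_forall fun x => ⟨unitInterval.nonneg', unitInterval.le_one'⟩
  have := dense_pi (univ : Set (Fin n)) (s := fun _ => Ioo (0 : I) 1) fun _ _ => h
  refine this.mono ?_
  intro a ha i
  exact ha i trivial

/-- Copulas that agree in the open cube are equal. -/
lemma IsCopula.eq_of_eqOn {C C' : (Fin 3 → I) → I} (hC : IsCopula C) (hC' : IsCopula C')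
    (h : ∀ a : Fin 3 → I, (∀ i, a i ∈ Ioo 0 1) → C a = C' a) : C = C' := by
  have := hC.continuous_coe.ext_on dense_open_unit_cube hC'.continuous_coe
    fun a ha => congrArg Subtype.val (h a ha)
  exact funext fun a => Subtype.ext (congrFun this a)

/-! ### Uniqueness of the copula, and quantile functions -/

section
variable {Ω : Type*} [MeasurableSpace Ω] {P : Measure Ω} [IsProbabilityMeasure P]

/-- **Sklar's theorem**, uniqueness part, for continuous margins. -/
lemma IsCopulaOf.unique {X : Fin 3 → Ω → ℝ} (hX : ∀ i, AEMeasurable (X i) P)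
    (hc : ∀ i, Continuous (marginCDF P (X i))) {C C' : (Fin 3 → I) → I} (h : IsCopulaOf P X C)
    (h' : IsCopulaOf P X C') : C = C' := by
  refine h.1.eq_of_eqOn h'.1 fun a ha => ?_
  choose x hx using fun i => exists_marginCDF_eq (hX i) (hc i) (ha i).1 (ha i).2
  rw [← funext hx]
  exact Subtype.ext ((h.2 x).symm.trans (h'.2 x))

/-- By continuity the set defining the quantile is closed, so its infimum is attained. -/
lemma marginCDF_quantileFn {Y : Ω → ℝ} (hY : AEMeasurable Y P) (hc : Continuous (marginCDF P Y))
    {p : I} (h0 : 0 < p) (h1 : p < 1) : marginCDF P Y (quantileFn P Y p) = p := by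
  obtain ⟨x, hx⟩ := exists_marginCDF_eq hY hc h0 h1
  have := Measure.isProbabilityMeasure_map hY
  have hb := (tendsto_cdf_atBot (P.map Y)).congr (cdf_map_eq_marginCDF hY)
  obtain ⟨a, ha⟩ := (hb.eventually_lt_const (show (0 : ℝ) < p from h0)).exists
  have hbdd : BddBelow {x | p ≤ marginCDF P Y x} := ⟨a, fun y hy => by
    by_contra hlt
    exact absurd (le_trans hy (marginCDF_mono Y (le_of_lt (not_le.1 hlt)))) (not_le.2 ha)⟩
  have hcl : IsClosed {x | p ≤ marginCDF P Y x} := isClosed_le continuous_const hc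
  have hmem : p ≤ marginCDF P Y (sInf {x | p ≤ marginCDF P Y x}) :=
    hcl.csInf_mem ⟨x, hx.ge⟩ hbdd
  exact le_antisymm ((marginCDF_mono Y (csInf_le hbdd hx.ge)).trans_eq hx) hmem

end

/-! ### The normal distribution function -/

/-- The jump of the distribution function at `a` is the mass of the atom at `a`. -/
lemma continuous_cdf_iff (μ : Measure ℝ) [IsProbabilityMeasure μ] :
    Continuous (cdf μ) ↔ ∀ a, μ {a} = 0 := by
  rw [continuous_iff_continuousAt]
  refine forall_congr' fun a => ?_
  have h : μ {a} = ENNReal.ofReal (cdf μ a - Function.leftLim (cdf μ) a) := by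
    conv_lhs => rw [← measure_cdf μ]
    exact StieltjesFunction.measure_singleton _ _
  have hle := (monotone_cdf μ).leftLim_le (le_refl a)
  rw [h, (monotone_cdf μ).continuousAt_iff_leftLim_eq_rightLim, StieltjesFunction.rightLim_eq,
    ENNReal.ofReal_eq_zero]
  exact ⟨fun h => by rw [h, sub_self], fun h => le_antisymm hle (by linarith)⟩

lemma gaussianReal_singleton {v : ℝ≥0} (hv : v ≠ 0) (a : ℝ) : gaussianReal 0 v {a} = 0 := by
  have := nullSingletonClass_gaussianReal (μ := 0) hv
  exact measure_singleton a

lemma continuous_stdNormalCDF : Continuous stdNormalCDF :=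
  (continuous_cdf_iff _).2 (gaussianReal_singleton one_ne_zero)

lemma strictMono_stdNormalCDF : StrictMono stdNormalCDF := fun a b hab => by
  have h : 0 < (gaussianReal 0 1).real (Ioc a b) := by
    refine ENNReal.toReal_pos (fun h0 => ?_) (measure_ne_top _ _)
    have := gaussianReal_absolutelyContinuous' 0 one_ne_zero h0
    simp [hab.not_ge] at this
  have h' : (gaussianReal 0 1).real (Iic b)
      = (gaussianReal 0 1).real (Iic a) + (gaussianReal 0 1).real (Ioc a b) := by
    rw [← Iic_union_Ioc_eq_Iic hab.le,
      measureReal_union (Iic_disjoint_Ioc le_rfl) measurableSet_Ioc]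
  unfold stdNormalCDF
  rw [cdf_eq_real, cdf_eq_real, h']
  linarith

lemma stdNormalCDF_neg (x : ℝ) : stdNormalCDF (-x) = 1 - stdNormalCDF x := by
  unfold stdNormalCDF
  rw [cdf_eq_real, cdf_eq_real]
  have h1 : (gaussianReal 0 1).real (Iic (-x)) = (gaussianReal 0 1).real (Ici x) := by
    have := gaussianReal_map_neg (μ := 0) (v := 1)
    rw [neg_zero] at this
    conv_lhs => rw [← this]
    rw [map_measureReal_apply measurable_neg measurableSet_Iic]
    congr 1
    ext y
    simp
  have h2 : (gaussianReal 0 1).real (Ici x) = (gaussianReal 0 1).real (Ioi x) := by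
    refine measureReal_congr ?_
    have := nullSingletonClass_gaussianReal (μ := 0) (v := 1) one_ne_zero
    exact Ioi_ae_eq_Ici.symm
  rw [h1, h2, ← compl_Iic, probReal_compl_eq_one_sub measurableSet_Iic]

lemma stdNormalCDF_zero : stdNormalCDF 0 = 1 / 2 := by
  have := stdNormalCDF_neg 0
  rw [neg_zero] at this
  linarith

lemma stdNormalCDF_pos (x : ℝ) : 0 < stdNormalCDF x :=
  (cdf_nonneg (gaussianReal 0 1) (x - 1)).trans_lt (strictMono_stdNormalCDF (by linarith))

lemma stdNormalCDF_lt_one (x : ℝ) : stdNormalCDF x < 1 :=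
  (strictMono_stdNormalCDF (show x < x + 1 by linarith)).trans_le
    (cdf_le_one (gaussianReal 0 1) (x + 1))

lemma stdNormalInv_stdNormalCDF (x : ℝ) : stdNormalInv (stdNormalCDF x) = x := by
  have : {y | stdNormalCDF x ≤ stdNormalCDF y} = Ici x := by
    ext y
    exact strictMono_stdNormalCDF.le_iff_le
  unfold stdNormalInv genInverse
  rw [this, csInf_Ici]

lemma stdNormalCDF_stdNormalInv {p : ℝ} (h0 : 0 < p) (h1 : p < 1) :
    stdNormalCDF (stdNormalInv p) = p := by
  obtain ⟨a, ha⟩ := ((tendsto_cdf_atBot (gaussianReal 0 1)).eventually_lt_const h0).exists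
  obtain ⟨b, hb⟩ := ((tendsto_cdf_atTop (gaussianReal 0 1)).eventually_const_lt h1).exists
  obtain ⟨x, rfl⟩ := mem_range_of_exists_le_of_exists_ge continuous_stdNormalCDF
    ⟨a, ha.le⟩ ⟨b, hb.le⟩
  rw [stdNormalInv_stdNormalCDF]

lemma gaussianReal_eq_map_sqrt_mul (t : ℝ≥0) :
    gaussianReal 0 t = (gaussianReal 0 1).map (√(t : ℝ) * ·) := by
  rw [gaussianReal_map_const_mul, mul_zero, mul_one]
  congr 1
  ext
  simp

lemma measureReal_gaussianReal_Iic {t : ℝ≥0} (ht : 0 < t) (x : ℝ) :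
    (gaussianReal 0 t).real (Iic (√(t : ℝ) * x)) = stdNormalCDF x := by
  have hc : 0 < √(t : ℝ) := Real.sqrt_pos.2 (by exact_mod_cast ht)
  unfold stdNormalCDF
  rw [cdf_eq_real, gaussianReal_eq_map_sqrt_mul,
    map_measureReal_apply (by fun_prop) measurableSet_Iic]
  congr 1
  ext y
  exact mul_le_mul_iff_right₀ hc

lemma measureReal_gaussianReal_Iio {t : ℝ≥0} (ht : 0 < t) (x : ℝ) :
    (gaussianReal 0 t).real (Iio (√(t : ℝ) * x)) = stdNormalCDF x := by
  have := nullSingletonClass_gaussianReal (μ := 0) ht.ne'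
  rw [← measureReal_gaussianReal_Iic ht, measureReal_congr Iio_ae_eq_Iic]

lemma measureReal_gaussianReal_Ioi {t : ℝ≥0} (ht : 0 < t) (x : ℝ) :
    (gaussianReal 0 t).real (Ioi (√(t : ℝ) * x)) = stdNormalCDF (-x) := by
  rw [stdNormalCDF_neg, ← measureReal_gaussianReal_Iic ht, ← compl_Iic,
    probReal_compl_eq_one_sub measurableSet_Iic]

lemma measureReal_gaussianReal_Ioo {t : ℝ≥0} (ht : 0 < t) {a b : ℝ} (hab : a ≤ b) :
    (gaussianReal 0 t).real (Ioo (√(t : ℝ) * a) (√(t : ℝ) * b))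
      = stdNormalCDF b - stdNormalCDF a := by
  have := nullSingletonClass_gaussianReal (μ := 0) ht.ne'
  have hab' : √(t : ℝ) * a ≤ √(t : ℝ) * b := by gcongr
  rw [measureReal_congr Ioo_ae_eq_Ioc, ← measureReal_gaussianReal_Iic ht b,
    ← Iic_union_Ioc_eq_Iic hab', measureReal_union (Iic_disjoint_Ioc le_rfl) measurableSet_Ioc,
    measureReal_gaussianReal_Iic ht]
  ring

/-! ### Periodic unions of intervals -/

/-- The union of the translates of `(a, b)` by the multiples of `s`. -/
def periodicIoo (a b s : ℝ) : Set ℝ := ⋃ k : ℤ, Ioo (a + k * s) (b + k * s)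

lemma mem_periodicIoo {a b s x : ℝ} :
    x ∈ periodicIoo a b s ↔ ∃ k : ℤ, a + k * s < x ∧ x < b + k * s := by
  simp [periodicIoo]

lemma isOpen_periodicIoo (a b s : ℝ) : IsOpen (periodicIoo a b s) :=
  isOpen_iUnion fun _ => isOpen_Ioo

/-- The gaps between the intervals form another open periodic union, disjoint from the first. A
boundary point lies in neither, hence is an endpoint of the cell found by the floor function. -/
lemma frontier_periodicIoo_subset {a b s : ℝ} (hs : 0 < s) :
    frontier (periodicIoo a b s)
      ⊆ range (fun k : ℤ => a + k * s) ∪ range (fun k : ℤ => b + k * s) := by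
  have hdisj : Disjoint (periodicIoo a b s) (periodicIoo b (a + s) s) := by
    rw [Set.disjoint_left]
    intro x hx hx'
    obtain ⟨k, hk1, hk2⟩ := mem_periodicIoo.1 hx
    obtain ⟨l, hl1, hl2⟩ := mem_periodicIoo.1 hx'
    have h1 : (l : ℝ) < k := lt_of_mul_lt_mul_right (show (l : ℝ) * s < k * s by linarith) hs.le
    have h2 : (k : ℝ) < l + 1 :=
      lt_of_mul_lt_mul_right (show (k : ℝ) * s < (l + 1) * s by linarith) hs.le
    have h1' : l < k := by exact_mod_cast h1
    have h2' : k < l + 1 := by exact_mod_cast h2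
    omega
  intro x hx
  by_contra hx'
  rw [mem_union, not_or] at hx'
  rw [(isOpen_periodicIoo a b s).frontier_eq] at hx
  have hx2 : x ∉ periodicIoo b (a + s) s := fun h =>
    (hdisj.symm.closure_right (isOpen_periodicIoo _ _ _)).le_bot ⟨h, hx.1⟩
  have h1 := Int.floor_le ((x - a) / s)
  have h2 := Int.lt_floor_add_one ((x - a) / s)
  rw [le_div_iff₀ hs] at h1
  rw [div_lt_iff₀ hs] at h2
  set k := ⌊(x - a) / s⌋
  have h3 : a + k * s ≠ x := fun h => hx'.1 ⟨k, h⟩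
  have h4 : b + k * s ≠ x := fun h => hx'.2 ⟨k, h⟩
  have h5 : a + k * s < x := lt_of_le_of_ne (by linarith) h3
  rcases lt_or_gt_of_ne h4 with h6 | h6
  · exact hx2 (mem_periodicIoo.2 ⟨k, h6, by linarith⟩)
  · exact hx.2 (mem_periodicIoo.2 ⟨k, h5, h6⟩)

lemma measure_frontier_periodicIoo {a b s : ℝ} (hs : 0 < s)
    (μ : Measure ℝ) [NullSingletonClass μ] : μ (frontier (periodicIoo a b s)) = 0 :=
  measure_mono_null (frontier_periodicIoo_subset hs)
    (((countable_range _).union (countable_range _)).measure_zero μ)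

lemma hasSum_measureReal_periodicIoo {a b s : ℝ} (hs : 0 < s) (hb : b ≤ a + s)
    (μ : Measure ℝ) [IsFiniteMeasure μ] :
    HasSum (fun k : ℤ => μ.real (Ioo (a + k * s) (b + k * s))) (μ.real (periodicIoo a b s)) := by
  have hd : Pairwise (Function.onFun Disjoint fun k : ℤ => Ioo (a + k * s) (b + k * s)) := by
    intro k l hkl
    rw [Function.onFun, Set.disjoint_left]
    rintro x ⟨hk1, hk2⟩ ⟨hl1, hl2⟩
    have h1 : (l : ℝ) < k + 1 :=
      lt_of_mul_lt_mul_right (show (l : ℝ) * s < (k + 1) * s by linarith) hs.le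
    have h2 : (k : ℝ) < l + 1 :=
      lt_of_mul_lt_mul_right (show (k : ℝ) * s < (l + 1) * s by linarith) hs.le
    have h1' : l < k + 1 := by exact_mod_cast h1
    have h2' : k < l + 1 := by exact_mod_cast h2
    omega
  have hm := measure_iUnion (μ := μ) hd fun k => measurableSet_Ioo
  have hfin : ∑' k : ℤ, μ (Ioo (a + k * s) (b + k * s)) ≠ ⊤ := by
    rw [← hm]; exact measure_ne_top _ _
  have := ENNReal.hasSum_toReal hfin
  rwa [← ENNReal.tsum_toReal_eq fun k => measure_ne_top _ _, ← hm] at this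

/-! ### Joint law of Brownian motion and the event of staying in an interval -/

section
variable {Ω : Type*} [MeasurableSpace Ω] {P : Measure Ω} {W : ℝ≥0 → Ω → ℝ}

/-- The **reflection principle** for a set `A` inside `D` and its mirror image `B` outside. -/
theorem measureReal_mem_and_forall_mem (hW : IsBrownianReal W P) {D : Set ℝ} (hD : IsClosed D)
    (h0 : (0 : ℝ) ∈ D) {A B : Set ℝ} (hA : IsOpen A) (hB : IsOpen B) {t : ℝ≥0}
    (hAf : gaussianReal 0 t (frontier A) = 0) (hBf : gaussianReal 0 t (frontier B) = 0)
    (hAB : ∀ b ∈ frontier D, ∀ x, 2 * b - x ∈ A ↔ x ∈ B) (hBD : Disjoint B D) :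
    P.real {ω | W t ω ∈ A ∧ ∀ s ≤ t, W s ω ∈ D}
      = (gaussianReal 0 t).real A - (gaussianReal 0 t).real B := by
  classical
  -- The test function is `1_A - 1_B`: reflections at the boundary of `D` exchange `A` and `B`, and
  -- on paths staying in `D` only `1_A` survives.
  have hf : ∀ x, (A.indicator 1 x - B.indicator 1 x : ℝ)
      = (if x ∈ A then 1 else 0) - (if x ∈ B then 1 else 0) := fun x => by
    simp [indicator]
  have key := integral_indicator_forall_mem_eq hW hD h0
    (f := fun x => A.indicator 1 x - B.indicator 1 x)
    ((measurable_one.indicator hA.measurableSet).sub (measurable_one.indicator hB.measurableSet))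
    (B := 1) (fun x => by rw [hf]; split_ifs <;> norm_num)
    (fun b hb x => by
      have h1 := hAB b hb x
      have h2 := hAB b hb (2 * b - x)
      rw [sub_sub_cancel] at h2
      simp only [hf, h1, ← h2]
      ring) (t := t)
    (by
      filter_upwards [measure_eq_zero_iff_ae_notMem.1 hAf, measure_eq_zero_iff_ae_notMem.1 hBf]
        with x h1 h2
      exact (continuousOn_const.continuousAt_indicator h1).sub
        (continuousOn_const.continuousAt_indicator h2))
  have hE : NullMeasurableSet {ω | W t ω ∈ A ∧ ∀ s ≤ t, W s ω ∈ D} P :=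
    ((hW.aemeasurable t).nullMeasurable hA.measurableSet).inter
      (nullMeasurableSet_forall_mem hW hD t)
  have hl : ∀ ω, {ω | ∀ s ≤ t, W s ω ∈ D}.indicator
      (fun ω => (A.indicator 1 (W t ω) - B.indicator 1 (W t ω) : ℝ)) ω
      = {ω | W t ω ∈ A ∧ ∀ s ≤ t, W s ω ∈ D}.indicator (fun _ => (1 : ℝ)) ω := fun ω => by
    by_cases h : ∀ s ≤ t, W s ω ∈ D
    · have hBn : W t ω ∉ B := fun hb => hBD.le_bot ⟨hb, h t le_rfl⟩
      by_cases hA' : W t ω ∈ A <;> simp [indicator, hBn, hA']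
    · simp [indicator, h]
  rw [integral_congr_ae (ae_of_all _ hl), integral_indicator₀ hE,
    integral_sub ((integrable_const 1).indicator hA.measurableSet)
      ((integrable_const 1).indicator hB.measurableSet),
    integral_indicator_one hA.measurableSet, integral_indicator_one hB.measurableSet] at key
  simpa using key

lemma ae_eval_ne (hW : IsBrownianReal W P) {t : ℝ≥0} (ht : 0 < t) (a : ℝ) :
    ∀ᵐ ω ∂P, W t ω ≠ a := by
  have hl := hW.hasLaw_eval t
  have : ∀ᵐ w ∂(P.map (W t)), w ≠ a := by
    rw [hl.map_eq]
    exact measure_eq_zero_iff_ae_notMem.1 (gaussianReal_singleton ht.ne' _)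
  exact ae_of_ae_map hl.aemeasurable this

lemma measureReal_le_and_forall_le (hW : IsBrownianReal W P) {t : ℝ≥0} (ht : 0 < t) {x y : ℝ}
    (hy : 0 ≤ y) (hxy : x ≤ y) :
    P.real {ω | W t ω ≤ √(t : ℝ) * x ∧ ∀ s ≤ t, W s ω ≤ √(t : ℝ) * y}
      = stdNormalCDF x - stdNormalCDF (x - 2 * y) := by
  have hc : 0 < √(t : ℝ) := Real.sqrt_pos.2 (by exact_mod_cast ht)
  have hna := nullSingletonClass_gaussianReal (μ := 0) ht.ne'
  have h := measureReal_mem_and_forall_mem hW (D := Iic (√(t : ℝ) * y)) isClosed_Iic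
    (by simp only [mem_Iic]; positivity) (A := Iio (√(t : ℝ) * x))
    (B := Ioi (√(t : ℝ) * (2 * y - x))) isOpen_Iio isOpen_Ioi (t := t)
    (by rw [frontier_Iio]; exact measure_singleton _)
    (by rw [frontier_Ioi]; exact measure_singleton _)
    (by
      intro b hb w
      rw [frontier_Iic, mem_singleton_iff] at hb
      subst hb
      simp only [mem_Iio, mem_Ioi]
      constructor <;> intro h <;> linarith)
    (by
      rw [Set.disjoint_left]
      intro w hw hw'
      rw [mem_Ioi] at hw
      rw [mem_Iic] at hw'
      have : √(t : ℝ) * y ≤ √(t : ℝ) * (2 * y - x) := by gcongr; linarith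
      linarith)
  rw [measureReal_gaussianReal_Iio ht, measureReal_gaussianReal_Ioi ht, neg_sub] at h
  rw [← h]
  refine measureReal_congr ?_
  filter_upwards [ae_eval_ne hW ht (√(t : ℝ) * x)] with ω hω
  exact propext (and_congr_left' ⟨fun h => lt_of_le_of_ne h hω, fun h => le_of_lt h⟩)

lemma hasSum_gaussianReal_periodicIoo {t : ℝ≥0} (ht : 0 < t) {a b s : ℝ} (hab : a ≤ b)
    (hs : 0 < s) (hb : b ≤ a + s) :
    HasSum (fun k : ℤ => stdNormalCDF (b + k * s) - stdNormalCDF (a + k * s))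
      ((gaussianReal 0 t).real
        (periodicIoo (√(t : ℝ) * a) (√(t : ℝ) * b) (√(t : ℝ) * s))) := by
  have hc : 0 < √(t : ℝ) := Real.sqrt_pos.2 (by exact_mod_cast ht)
  have h := hasSum_measureReal_periodicIoo (a := √(t : ℝ) * a) (b := √(t : ℝ) * b)
    (s := √(t : ℝ) * s) (by positivity) (by rw [← mul_add]; gcongr) (gaussianReal 0 t)
  convert h using 2 with k
  rw [← measureReal_gaussianReal_Ioo ht (by linarith)]
  congr 2 <;> ring

/-- The law of Brownian motion killed at the boundary of an interval, as a series. -/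
lemma hasSum_measureReal_mem_Ioo_and_forall_mem_Icc (hW : IsBrownianReal W P) {t : ℝ≥0}
    (ht : 0 < t) {x y z : ℝ} (hy : 0 ≤ y) (hz : z ≤ 0) (hzx : z < x) (hxy : x ≤ y) :
    HasSum (fun k : ℤ => (stdNormalCDF (x + k * (2 * (y - z))) - stdNormalCDF (z + k * (2 * (y - z))))
        - (stdNormalCDF (z + k * (2 * (y - z))) - stdNormalCDF (2 * z - x + k * (2 * (y - z)))))
      (P.real {ω | W t ω ∈ Ioo (√(t : ℝ) * z) (√(t : ℝ) * x) ∧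
        ∀ s ≤ t, W s ω ∈ Icc (√(t : ℝ) * z) (√(t : ℝ) * y)}) := by
  have hc : 0 < √(t : ℝ) := Real.sqrt_pos.2 (by exact_mod_cast ht)
  have hna := nullSingletonClass_gaussianReal (μ := 0) ht.ne'
  set c := √(t : ℝ) with hcdef
  set s := 2 * (y - z) with hs
  have hs0 : 0 < s := by rw [hs]; linarith
  have hcz : c * z ≤ 0 := mul_nonpos_of_nonneg_of_nonpos hc.le hz
  have hcy : 0 ≤ c * y := by positivity
  have hczx : c * z < c * x := by gcongr
  have hcxy : c * x ≤ c * y := by gcongr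
  have hcs : c * s = 2 * (c * y - c * z) := by rw [hs]; ring
  have hcs0 : 0 < c * s := by positivity
  -- The two reflections compose to the translation by `c * s = 2 (c * y - c * z)`, so a set
  -- compatible with both is periodic. The reflection at `c * z` sends the index `k` to `-k`, the
  -- one at `c * y` sends it to `1 - k`.
  have key := measureReal_mem_and_forall_mem hW (D := Icc (c * z) (c * y)) isClosed_Icc
    ⟨hcz, hcy⟩ (A := periodicIoo (c * z) (c * x) (c * s))
    (B := periodicIoo (c * (2 * z - x)) (c * z) (c * s)) (isOpen_periodicIoo _ _ _)
    (isOpen_periodicIoo _ _ _) (t := t)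
    (measure_frontier_periodicIoo hcs0 _)
    (measure_frontier_periodicIoo hcs0 _)
    (by
      intro b hb w
      rw [frontier_Icc (by linarith)] at hb
      simp only [mem_periodicIoo]
      rcases hb with rfl | rfl
      · constructor <;> rintro ⟨k, h1, h2⟩ <;>
          exact ⟨-k, by push_cast; linarith, by push_cast; linarith⟩
      · constructor <;> rintro ⟨k, h1, h2⟩ <;>
          exact ⟨1 - k, by push_cast; linarith, by push_cast; linarith⟩)
    (by
      rw [Set.disjoint_left]
      rintro w hw ⟨hw1, hw2⟩
      obtain ⟨k, hk1, hk2⟩ := mem_periodicIoo.1 hw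
      rcases le_or_gt k 0 with hk | hk
      · have : (k : ℝ) * (c * s) ≤ 0 :=
          mul_nonpos_of_nonpos_of_nonneg (by exact_mod_cast hk) hcs0.le
        linarith
      · have : 1 * (c * s) ≤ (k : ℝ) * (c * s) :=
          mul_le_mul_of_nonneg_right (by exact_mod_cast hk) hcs0.le
        linarith)
  -- Of all translates, only the one with `k = 0` meets `[c * z, c * y]`.
  have hset : {ω | W t ω ∈ Ioo (c * z) (c * x) ∧ ∀ s ≤ t, W s ω ∈ Icc (c * z) (c * y)}
      = {ω | W t ω ∈ periodicIoo (c * z) (c * x) (c * s) ∧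
        ∀ s ≤ t, W s ω ∈ Icc (c * z) (c * y)} := by
    ext ω
    refine and_congr_left fun hω => ?_
    obtain ⟨hw1, hw2⟩ := hω t le_rfl
    rw [mem_periodicIoo]
    refine ⟨fun h => ⟨0, by simpa using h⟩, ?_⟩
    rintro ⟨k, hk1, hk2⟩
    rcases lt_trichotomy k 0 with hk | rfl | hk
    · have : (k : ℝ) * (c * s) ≤ (-1) * (c * s) :=
        mul_le_mul_of_nonneg_right (by exact_mod_cast Int.le_sub_one_of_lt hk) hcs0.le
      linarith
    · simpa using And.intro hk1 hk2
    · have : 1 * (c * s) ≤ (k : ℝ) * (c * s) :=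
        mul_le_mul_of_nonneg_right (by exact_mod_cast hk) hcs0.le
      linarith
  rw [hset, key]
  exact (hasSum_gaussianReal_periodicIoo ht hzx.le hs0 (by linarith)).sub
    (hasSum_gaussianReal_periodicIoo ht (by linarith) hs0 (by linarith))

end

lemma zero_le_stdNormalInv {v : ℝ} (h0 : 0 ≤ v) (h1 : v < 1) : 0 ≤ stdNormalInv ((1 + v) / 2) := by
  rw [← strictMono_stdNormalCDF.le_iff_le, stdNormalCDF_stdNormalInv (by linarith) (by linarith),
    stdNormalCDF_zero]
  linarith

lemma stdNormalInv_le_zero {w : ℝ} (h0 : 0 < w) (h1 : w ≤ 1) : stdNormalInv (w / 2) ≤ 0 := by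
  rw [← strictMono_stdNormalCDF.le_iff_le, stdNormalCDF_stdNormalInv (by linarith) (by linarith),
    stdNormalCDF_zero]
  linarith

/-! ### The series -/

/-- Since `r ≤ s`, the intervals `(q - r - ks, q - ks]` do not overlap, and a telescoping sum bounds
their total mass by `1`. -/
lemma summable_psiTerm {r s : ℝ} (hr : 0 ≤ r) (hrs : r ≤ s) (q : ℝ) : Summable (psiTerm q r s) := by
  have hmono := strictMono_stdNormalCDF.monotone
  refine summable_of_sum_range_le (c := 1) (fun k => ?_) fun n => ?_
  · exact sub_nonneg.2 (hmono (by linarith))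
  · calc ∑ k ∈ Finset.range n, psiTerm q r s k
        ≤ ∑ k ∈ Finset.range n, (stdNormalCDF (q - (k : ℕ) * s)
          - stdNormalCDF (q - ((k + 1 : ℕ) : ℝ) * s)) := by
          refine Finset.sum_le_sum fun k _ => ?_
          unfold psiTerm
          have := hmono (show q - ((k + 1 : ℕ) : ℝ) * s ≤ q - r - k * s by push_cast; linarith)
          linarith
      _ = stdNormalCDF (q - (0 : ℕ) * s) - stdNormalCDF (q - (n : ℕ) * s) :=
          Finset.sum_range_sub' (fun k : ℕ => stdNormalCDF (q - (k : ℝ) * s)) n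
      _ ≤ 1 := by
          have h1 := stdNormalCDF_lt_one (q - (0 : ℕ) * s)
          have h2 := stdNormalCDF_pos (q - (n : ℕ) * s)
          linarith

lemma psiSeries_eq_add {r s : ℝ} (hr : 0 ≤ r) (hrs : r ≤ s) (q : ℝ) :
    psiSeries q r s = stdNormalCDF q - stdNormalCDF (q - r) + psiSeries (q - s) r s := by
  unfold psiSeries
  rw [(summable_psiTerm hr hrs q).tsum_eq_zero_add]
  congr 1
  · simp [psiTerm]
  · refine tsum_congr fun k => ?_
    unfold psiTerm
    push_cast
    congr 2 <;> ring

/-- The indices `-k ≥ 0` give the first series; the remaining ones are mirrored by `Φ(-a) = 1 -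
Φ(a)` into a series of the same kind. -/
lemma hasSum_int_psi {r s : ℝ} (hr : 0 ≤ r) (hrs : r ≤ s) (q : ℝ) :
    HasSum (fun k : ℤ => stdNormalCDF (q + k * s) - stdNormalCDF (q - r + k * s))
      (psiSeries q r s + psiSeries (-q - s + r) r s) := by
  have h : HasSum (fun k : ℤ => stdNormalCDF (q - k * s) - stdNormalCDF (q - r - k * s))
      (psiSeries q r s + psiSeries (-q - s + r) r s) := by
    refine HasSum.of_nat_of_neg_add_one (summable_psiTerm hr hrs q).hasSum ?_
    refine (summable_psiTerm hr hrs (-q - s + r)).hasSum.congr_fun fun k => ?_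
    unfold psiTerm
    rw [show -q - s + r - k * s = -(q - r - ((-(k + 1) : ℤ) : ℝ) * s) by push_cast; ring,
      show -q - s + r - r - k * s = -(q - ((-(k + 1) : ℤ) : ℝ) * s) by push_cast; ring,
      stdNormalCDF_neg, stdNormalCDF_neg]
    ring
  rw [← (Equiv.neg ℤ).hasSum_iff]
  convert h using 2 with k
  simp [sub_eq_add_neg]

lemma psiSeries_zero_width (q s : ℝ) : psiSeries q 0 s = 0 := by
  simp [psiSeries, psiTerm]

/-! ### Running extrema -/

section
variable {Ω : Type*} {W : ℝ≥0 → Ω → ℝ}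

lemma runningMax_le_iff {ω : Ω} (hω : Continuous (W · ω)) {t : ℝ≥0} {a : ℝ} :
    runningMax W t ω ≤ a ↔ ∀ s ≤ t, W s ω ≤ a := by
  have hb : BddAbove ((fun s => W s ω) '' Icc 0 t) :=
    (isCompact_Icc.image hω).bddAbove
  have hne : ((fun s => W s ω) '' Icc 0 t).Nonempty := ⟨_, 0, ⟨le_rfl, zero_le⟩, rfl⟩
  unfold runningMax
  rw [csSup_le_iff hb hne, forall_mem_image]
  exact ⟨fun h s hs => h ⟨zero_le, hs⟩, fun h s hs => h s hs.2⟩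

lemma le_runningMin_iff {ω : Ω} (hω : Continuous (W · ω)) {t : ℝ≥0} {a : ℝ} :
    a ≤ runningMin W t ω ↔ ∀ s ≤ t, a ≤ W s ω := by
  have hb : BddBelow ((fun s => W s ω) '' Icc 0 t) :=
    (isCompact_Icc.image hω).bddBelow
  have hne : ((fun s => W s ω) '' Icc 0 t).Nonempty := ⟨_, 0, ⟨le_rfl, zero_le⟩, rfl⟩
  unfold runningMin
  rw [le_csInf_iff hb hne, forall_mem_image]
  exact ⟨fun h s hs => h ⟨zero_le, hs⟩, fun h s hs => h s hs.2⟩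

lemma runningMin_eq_neg_runningMax_neg (t : ℝ≥0) (ω : Ω) :
    runningMin W t ω = -runningMax (-W) t ω := by
  unfold runningMin runningMax
  rw [Real.sInf_def, ← image_neg_eq_neg, image_image]
  rfl

end

/-! ### The laws of the running extrema and of the triple -/

section
variable {Ω : Type*} [MeasurableSpace Ω] {P : Measure Ω} {W : ℝ≥0 → Ω → ℝ}

lemma aemeasurable_runningMax (hW : IsBrownianReal W P) (t : ℝ≥0) :
    AEMeasurable (runningMax W t) P := by
  have h : ∀ a, NullMeasurableSet (runningMax W t ⁻¹' Iic a) P := fun a => by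
    refine (nullMeasurableSet_forall_mem hW (D := Iic a) isClosed_Iic t).congr ?_
    filter_upwards [hW.cont] with ω hω
    exact propext (runningMax_le_iff hω).symm
  -- Paths are continuous only almost surely, so measurability is obtained for the completed
  -- σ-algebra.
  have h' : NullMeasurable (runningMax W t) P := fun s hs =>
    measurable_of_Iic (δ := NullMeasurableSpace Ω P) h hs
  exact h'.aemeasurable

lemma aemeasurable_runningMin (hW : IsBrownianReal W P) (t : ℝ≥0) :
    AEMeasurable (runningMin W t) P := by
  rw [funext fun ω => runningMin_eq_neg_runningMax_neg (W := W) t ω]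
  exact (aemeasurable_runningMax hW.neg t).neg

lemma aemeasurable_tripleAt (hW : IsBrownianReal W P) (t : ℝ≥0) (i : Fin 3) :
    AEMeasurable (tripleAt W t i) P := by
  fin_cases i
  · exact hW.aemeasurable t
  · exact aemeasurable_runningMax hW t
  · exact aemeasurable_runningMin hW t


lemma measureReal_eval_le (hW : IsBrownianReal W P) {t : ℝ≥0} (ht : 0 < t) (x : ℝ) :
    P.real {ω | W t ω ≤ √(t : ℝ) * x} = stdNormalCDF x := by
  rw [← measureReal_gaussianReal_Iic ht]
  exact (hW.hasLaw_eval t).measureReal_eq measurableSet_Iic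

lemma jointCDF_tripleAt_eq (t : ℝ≥0) (a b c : ℝ) : jointCDF P (tripleAt W t) ![a, b, c]
    = P.real {ω | (W t ω ≤ a ∧ runningMax W t ω ≤ b) ∧ runningMin W t ω ≤ c} := by
  unfold jointCDF
  congr 1
  ext ω
  simp [tripleAt, Fin.forall_fin_succ, and_assoc]

/-- The killed-path series, resummed. -/
lemma measureReal_mem_Ioo_and_forall_mem_Icc (hW : IsBrownianReal W P) {t : ℝ≥0}
    (ht : 0 < t) {x y z : ℝ} (hy : 0 ≤ y) (hz : z ≤ 0) (hzx : z < x) (hxy : x ≤ y) :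
    P.real {ω | W t ω ∈ Ioo (√(t : ℝ) * z) (√(t : ℝ) * x) ∧
        ∀ s ≤ t, W s ω ∈ Icc (√(t : ℝ) * z) (√(t : ℝ) * y)}
      = stdNormalCDF x - stdNormalCDF (x - 2 * y) + psiSeries (x - 2 * (y - z)) (2 * y) (2 * (y - z))
        + psiSeries (-x - 2 * (y - z) + 2 * y) (2 * y) (2 * (y - z))
        - 2 * psiSeries z (2 * y) (2 * (y - z)) := by
  have hr : 0 ≤ 2 * y := by linarith
  have hrs : 2 * y ≤ 2 * (y - z) := by linarith
  have h := hasSum_measureReal_mem_Ioo_and_forall_mem_Icc hW ht hy hz hzx hxy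
  have hx := hasSum_int_psi hr hrs x
  have hz' := hasSum_int_psi hr hrs z
  set s := 2 * (y - z) with hs
  generalize P.real _ = U at h ⊢
  set g : ℤ → ℝ := fun k => stdNormalCDF (z + k * s) - stdNormalCDF (2 * z - x + k * s) with hg
  set g' : ℤ → ℝ := fun k => stdNormalCDF (x - 2 * y + k * s) - stdNormalCDF (z - 2 * y + k * s)
    with hg'
  -- The symmetry of `Φ` together with `s = 2 (y - z)` turns `g'` into `g` run backwards.
  have hgg : ∀ k, g' k = g (1 - k) := fun k => by
    simp only [hg, hg']
    rw [show x - 2 * y + k * s = -(2 * z - x + ((1 - k : ℤ) : ℝ) * s) by push_cast; rw [hs]; ring,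
      show z - 2 * y + k * s = -(z + ((1 - k : ℤ) : ℝ) * s) by push_cast; rw [hs]; ring,
      stdNormalCDF_neg, stdNormalCDF_neg]
    ring
  -- The `Ψ` series and the killed-path series differ termwise by an expression that is odd under `k
  -- ↦ 1 - k`; its sum equals its own negative, hence vanishes.
  have hd : HasSum (fun k => g k - g (1 - k)) (psiSeries x (2 * y) s
      + psiSeries (-x - s + 2 * y) (2 * y) s
      - (psiSeries z (2 * y) s + psiSeries (-z - s + 2 * y) (2 * y) s) - U) := by
    refine ((hx.sub hz').sub h).congr_fun fun k => ?_
    rw [← hgg]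
    simp only [hg, hg']
    ring
  have hd' := (Equiv.subLeft (1 : ℤ)).hasSum_iff.2 hd
  have hd0 := hd'.unique (hd.neg.congr_fun fun k => by
    simp only [Function.comp_apply, Equiv.subLeft_apply, sub_sub_cancel]
    ring)
  rw [show -z - s + 2 * y = z by rw [hs]; ring, psiSeries_eq_add hr hrs x] at hd0
  linarith


/-- `W t ≤ x`, `M t ≤ y`, without the running minimum. -/
lemma measureReal_le_and_runningMax_le (hW : IsBrownianReal W P) {t : ℝ≥0} (ht : 0 < t) {x y : ℝ}
    (hy : 0 ≤ y) (hxy : x ≤ y) :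
    P.real {ω | W t ω ≤ √(t : ℝ) * x ∧ runningMax W t ω ≤ √(t : ℝ) * y}
      = stdNormalCDF x - stdNormalCDF (x - 2 * y) := by
  rw [← measureReal_le_and_forall_le hW ht hy hxy]
  refine measureReal_congr ?_
  filter_upwards [hW.cont] with ω hω
  exact propext (and_congr_right' (runningMax_le_iff hω))

lemma jointCDF_tripleAt_of_le (hW : IsBrownianReal W P) {t : ℝ≥0} (ht : 0 < t) {x y z : ℝ}
    (hy : 0 ≤ y) (hz : z ≤ 0) (hxz : x ≤ z) :
    jointCDF P (tripleAt W t) ![√(t : ℝ) * x, √(t : ℝ) * y, √(t : ℝ) * z]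
      = stdNormalCDF x - stdNormalCDF (x - 2 * y) := by
  rw [jointCDF_tripleAt_eq, ← measureReal_le_and_runningMax_le hW ht hy (hxz.trans (hz.trans hy))]
  refine measureReal_congr ?_
  filter_upwards [hW.cont] with ω hω
  refine propext ⟨fun h => h.1, fun h => ⟨h, ?_⟩⟩
  have h1 : √(t : ℝ) * x ≤ √(t : ℝ) * z := by gcongr
  exact ((le_runningMin_iff hω).1 le_rfl t le_rfl).trans (h.1.trans h1)

variable [IsProbabilityMeasure P]

lemma measureReal_runningMax_le (hW : IsBrownianReal W P) {t : ℝ≥0} (ht : 0 < t) (y : ℝ) :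
    P.real {ω | runningMax W t ω ≤ √(t : ℝ) * y} = max 0 (2 * stdNormalCDF y - 1) := by
  have hc : 0 < √(t : ℝ) := Real.sqrt_pos.2 (by exact_mod_cast ht)
  rcases le_or_gt 0 y with hy | hy
  · have h := measureReal_le_and_forall_le hW ht hy le_rfl
    rw [show y - 2 * y = -y by ring, stdNormalCDF_neg] at h
    have h1 := strictMono_stdNormalCDF.monotone hy
    rw [stdNormalCDF_zero] at h1
    rw [max_eq_right (by linarith)]
    refine Eq.trans (measureReal_congr ?_) (h.trans (by ring))
    filter_upwards [hW.cont] with ω hω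
    exact propext ((runningMax_le_iff hω).trans ⟨fun h => ⟨h t le_rfl, h⟩, fun h => h.2⟩)
  · have h1 := strictMono_stdNormalCDF hy
    rw [stdNormalCDF_zero] at h1
    rw [max_eq_left (by linarith), measureReal_eq_zero_iff]
    refine measure_eq_zero_iff_ae_notMem.2 ?_
    filter_upwards [hW.cont, hW.eval_zero_ae_eq_zero] with ω hω h0 hle
    have := (runningMax_le_iff hω).1 hle 0 zero_le
    rw [h0] at this
    nlinarith

lemma measure_eq_singleton_of_continuous {Y : Ω → ℝ} (hY : AEMeasurable Y P)
    (hc : Continuous fun x => P.real {ω | Y ω ≤ x}) (a : ℝ) : P {ω | Y ω = a} = 0 := by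
  have := Measure.isProbabilityMeasure_map hY
  have h := (continuous_cdf_iff (P.map Y)).1 (by
    rwa [show ⇑(cdf (P.map Y)) = fun x => P.real {ω | Y ω ≤ x} from
      funext (cdf_map_eq_marginCDF hY)]) a
  rwa [Measure.map_apply_of_aemeasurable hY (measurableSet_singleton a)] at h

lemma continuous_of_scaled {c : ℝ} (hc : 0 < c) {F G : ℝ → ℝ} (hG : Continuous G)
    (h : ∀ x, F (c * x) = G x) : Continuous F := by
  have : F = fun x => G (x / c) := funext fun x => by rw [← h, mul_div_cancel₀ _ hc.ne']
  rw [this]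
  fun_prop

lemma continuous_measureReal_runningMax_le (hW : IsBrownianReal W P) {t : ℝ≥0} (ht : 0 < t) :
    Continuous fun x => P.real {ω | runningMax W t ω ≤ x} := by
  have := continuous_stdNormalCDF
  exact continuous_of_scaled (Real.sqrt_pos.2 (by exact_mod_cast ht))
    (G := fun y => max 0 (2 * stdNormalCDF y - 1)) (by fun_prop) (measureReal_runningMax_le hW ht)

/-- Follows from the maximum of the Brownian motion `-W`; strict and weak inequalities agree because
that maximum has no atoms. -/
lemma measureReal_runningMin_le (hW : IsBrownianReal W P) {t : ℝ≥0} (ht : 0 < t) (z : ℝ) :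
    P.real {ω | runningMin W t ω ≤ √(t : ℝ) * z} = min 1 (2 * stdNormalCDF z) := by
  have hm := aemeasurable_runningMax hW.neg t
  have h1 : {ω | runningMin W t ω ≤ √(t : ℝ) * z}
      = {ω | runningMax (-W) t ω < √(t : ℝ) * (-z)}ᶜ := by
    ext ω
    simp only [mem_compl_iff, mem_ofPred_eq, runningMin_eq_neg_runningMax_neg (W := W), not_lt]
    constructor <;> intro h <;> linarith
  have h2 : P.real {ω | runningMax (-W) t ω < √(t : ℝ) * (-z)}
      = P.real {ω | runningMax (-W) t ω ≤ √(t : ℝ) * (-z)} := by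
    refine measureReal_congr ?_
    have h0 := measure_eq_singleton_of_continuous hm (continuous_measureReal_runningMax_le hW.neg ht)
      (√(t : ℝ) * (-z))
    filter_upwards [measure_eq_zero_iff_ae_notMem.1 h0] with ω hω
    exact propext ⟨fun h => le_of_lt h, fun h => lt_of_le_of_ne h hω⟩
  have h3 : NullMeasurableSet {ω | runningMax (-W) t ω < √(t : ℝ) * (-z)} P :=
    hm.nullMeasurable measurableSet_Iio
  rw [h1, probReal_compl_eq_one_sub₀ h3, h2,
    measureReal_runningMax_le hW.neg ht, stdNormalCDF_neg]
  rcases le_total (2 * stdNormalCDF z) 1 with h | h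
  · rw [min_eq_right h, max_eq_right (by linarith)]; ring
  · rw [min_eq_left h, max_eq_left (by linarith)]; ring

lemma continuous_measureReal_runningMin_le (hW : IsBrownianReal W P) {t : ℝ≥0} (ht : 0 < t) :
    Continuous fun x => P.real {ω | runningMin W t ω ≤ x} := by
  have := continuous_stdNormalCDF
  exact continuous_of_scaled (Real.sqrt_pos.2 (by exact_mod_cast ht))
    (G := fun y => min 1 (2 * stdNormalCDF y)) (by fun_prop) (measureReal_runningMin_le hW ht)

lemma continuous_marginCDF_tripleAt (hW : IsBrownianReal W P) {t : ℝ≥0} (ht : 0 < t) (i : Fin 3) :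
    Continuous (marginCDF P (tripleAt W t i)) := by
  refine Continuous.subtype_mk ?_ _
  fin_cases i
  · exact continuous_of_scaled (Real.sqrt_pos.2 (by exact_mod_cast ht)) continuous_stdNormalCDF
      (measureReal_eval_le hW ht)
  · exact continuous_measureReal_runningMax_le hW ht
  · exact continuous_measureReal_runningMin_le hW ht

lemma jointCDF_tripleAt_of_lt_of_le (hW : IsBrownianReal W P) {t : ℝ≥0} (ht : 0 < t) {x y z : ℝ}
    (hy : 0 ≤ y) (hz : z ≤ 0) (hzx : z < x) (hxy : x ≤ y) :
    jointCDF P (tripleAt W t) ![√(t : ℝ) * x, √(t : ℝ) * y, √(t : ℝ) * z]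
      = 2 * psiSeries z (2 * y) (2 * (y - z)) - psiSeries (x - 2 * (y - z)) (2 * y) (2 * (y - z))
        - psiSeries (-x - 2 * (y - z) + 2 * y) (2 * y) (2 * (y - z)) := by
  have h1 := measureReal_le_and_runningMax_le hW ht hy hxy
  have h2 := measureReal_mem_Ioo_and_forall_mem_Icc hW ht hy hz hzx hxy
  have hm : NullMeasurableSet {ω | runningMin W t ω ≤ √(t : ℝ) * z} P :=
    (aemeasurable_runningMin hW t).nullMeasurable measurableSet_Iic
  have h3 := measureReal_inter_add_sdiff₀ (μ := P)
    (s := {ω | W t ω ≤ √(t : ℝ) * x ∧ runningMax W t ω ≤ √(t : ℝ) * y}) hm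
  have hne := measure_eq_zero_iff_ae_notMem.1 (measure_eq_singleton_of_continuous
    (aemeasurable_runningMin hW t) (continuous_measureReal_runningMin_le hW ht) (√(t : ℝ) * z))
  -- The complement of `m_t ≤ z` is staying strictly above `z`; up to null sets this is staying in
  -- the closed interval, as neither `W_t` nor `m_t` has atoms.
  have h4 : P.real ({ω | W t ω ≤ √(t : ℝ) * x ∧ runningMax W t ω ≤ √(t : ℝ) * y}
        \ {ω | runningMin W t ω ≤ √(t : ℝ) * z})
      = P.real {ω | W t ω ∈ Ioo (√(t : ℝ) * z) (√(t : ℝ) * x) ∧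
        ∀ s ≤ t, W s ω ∈ Icc (√(t : ℝ) * z) (√(t : ℝ) * y)} := by
    refine measureReal_congr ?_
    filter_upwards [hW.cont, ae_eval_ne hW ht (√(t : ℝ) * x), hne] with ω hω hx hmin
    refine propext ⟨?_, ?_⟩
    · rintro ⟨⟨ha, hb⟩, hc⟩
      have hc' : √(t : ℝ) * z < runningMin W t ω := not_le.1 hc
      have hd := (le_runningMin_iff hω (t := t)).1 le_rfl
      exact ⟨⟨hc'.trans_le (hd t le_rfl), lt_of_le_of_ne ha hx⟩, fun s hs =>
        ⟨hc'.le.trans (hd s hs), (runningMax_le_iff hω).1 hb s hs⟩⟩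
    · rintro ⟨ha, hb⟩
      have hd : √(t : ℝ) * z ≤ runningMin W t ω := (le_runningMin_iff hω).2 fun s hs => (hb s hs).1
      exact ⟨⟨ha.2.le, (runningMax_le_iff hω).2 fun s hs => (hb s hs).2⟩,
        fun hc => hmin (le_antisymm hc hd)⟩
  rw [h4, h2, h1] at h3
  rw [jointCDF_tripleAt_eq]
  change P.real ({ω | W t ω ≤ √(t : ℝ) * x ∧ runningMax W t ω ≤ √(t : ℝ) * y}
    ∩ {ω | runningMin W t ω ≤ √(t : ℝ) * z}) = _
  linarith

lemma jointCDF_tripleAt_of_gt (hW : IsBrownianReal W P) {t : ℝ≥0} (ht : 0 < t) {x y z : ℝ}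
    (hy : 0 ≤ y) (hz : z ≤ 0) (hyx : y < x) :
    jointCDF P (tripleAt W t) ![√(t : ℝ) * x, √(t : ℝ) * y, √(t : ℝ) * z]
      = 2 * psiSeries z (2 * y) (2 * (y - z)) - 2 * psiSeries (2 * z - y) (2 * y) (2 * (y - z)) := by
  -- If `y = z = 0` the period is `0` and the interval argument fails, but then both sides vanish
  -- because `M_t > 0` almost surely.
  rcases eq_or_lt_of_le (hz.trans hy) with hzy | hzy
  · have hy0 : y = 0 := le_antisymm (hzy ▸ hz) hy
    subst hy0
    rw [mul_zero (2 : ℝ), psiSeries_zero_width, psiSeries_zero_width, jointCDF_tripleAt_eq]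
    refine le_antisymm ?_ (by simp)
    have h0 := measureReal_runningMax_le hW ht 0
    rw [stdNormalCDF_zero] at h0
    calc _ ≤ P.real {ω | runningMax W t ω ≤ √(t : ℝ) * 0} :=
          measureReal_mono fun ω hω => hω.1.2
      _ = _ := by rw [h0]; norm_num
  · have h := jointCDF_tripleAt_of_lt_of_le hW ht hy hz hzy le_rfl
    rw [show y - 2 * (y - z) = 2 * z - y by ring,
      show -y - 2 * (y - z) + 2 * y = 2 * z - y by ring] at h
    refine Eq.trans ?_ (h.trans (by ring))
    rw [jointCDF_tripleAt_eq, jointCDF_tripleAt_eq]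
    refine measureReal_congr ?_
    filter_upwards [hW.cont] with ω hω
    have h1 : √(t : ℝ) * y ≤ √(t : ℝ) * x := by gcongr
    refine propext (and_congr_left' ⟨fun h => ⟨(runningMax_le_iff hω).1 h.2 t le_rfl, h.2⟩,
      fun h => ⟨h.1.trans h1, h.2⟩⟩)

/-! ### The copula -/

/-- Any copula of `(W t, M t, m t)` is given by the formula. -/
lemma IsCopulaOf.eq_copulaFormula_of_lt_one (hW : IsBrownianReal W P) {t : ℝ≥0} (ht : 0 < t)
    {C : (Fin 3 → I) → I} (hC : IsCopulaOf P (tripleAt W t) C) {u v w : I} (hu : 0 < u)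
    (hu1 : u < 1) (hv : v < 1) (hw : 0 < w) : (C ![u, v, w] : ℝ) = copulaFormula u v w := by
  have hu' : (0 : ℝ) < u := hu
  have hu1' : (u : ℝ) < 1 := hu1
  have hv' : (v : ℝ) < 1 := hv
  have hw' : (0 : ℝ) < w := hw
  have hv0 : (0 : ℝ) ≤ v := v.2.1
  have hw1 : (w : ℝ) ≤ 1 := w.2.2
  have hx := stdNormalCDF_stdNormalInv hu' hu1'
  have hy := stdNormalCDF_stdNormalInv (p := (1 + v) / 2) (by linarith) (by linarith)
  have hz := stdNormalCDF_stdNormalInv (p := w / 2) (by linarith) (by linarith)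
  have hy0 := zero_le_stdNormalInv hv0 hv'
  have hz0 := stdNormalInv_le_zero hw' hw1
  unfold copulaFormula paramR paramS
  set x := stdNormalInv u
  set y := stdNormalInv ((1 + v) / 2)
  set z := stdNormalInv (w / 2)
  have hargs : (fun i => marginCDF P (tripleAt W t i)
      (![√(t : ℝ) * x, √(t : ℝ) * y, √(t : ℝ) * z] i)) = ![u, v, w] := by
    ext i
    fin_cases i
    · exact (measureReal_eval_le hW ht x).trans hx
    · refine (measureReal_runningMax_le hW ht y).trans ?_
      rw [hy, max_eq_right (by linarith)]
      simp only [Fin.mk_one, Matrix.cons_val_one, Matrix.cons_val_zero]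
      ring
    · refine (measureReal_runningMin_le hW ht z).trans ?_
      rw [hz, min_eq_right (by linarith)]
      simp only [Fin.reduceFinMk, Matrix.cons_val]
      ring
  rw [← hargs, ← hC.2]
  -- Applying `Φ` translates the regions in `u, v, w` into the order of `x, y, z`.
  have h1 : 2 * (u : ℝ) ≤ w ↔ x ≤ z := by
    rw [← strictMono_stdNormalCDF.le_iff_le (a := x), hx, hz]
    constructor <;> intro h <;> linarith
  have h2 : 2 * (u : ℝ) ≤ 1 + v ↔ x ≤ y := by
    rw [← strictMono_stdNormalCDF.le_iff_le (a := x), hx, hy]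
    constructor <;> intro h <;> linarith
  simp only [h1, h2]
  split_ifs with hxz hxy
  · rw [jointCDF_tripleAt_of_le hW ht hy0 hz0 hxz, hx]
  · exact jointCDF_tripleAt_of_lt_of_le hW ht hy0 hz0 (not_le.1 hxz) hxy
  · exact jointCDF_tripleAt_of_gt hW ht hy0 hz0 (not_le.1 hxy)

lemma IsCopulaOf.eq_copulaFormula (hW : IsBrownianReal W P) {t : ℝ≥0} (ht : 0 < t)
    {C : (Fin 3 → I) → I} (hC : IsCopulaOf P (tripleAt W t) C) {u v w : I} (hu : 0 < u)
    (hv : v < 1) (hw : 0 < w) : (C ![u, v, w] : ℝ) = copulaFormula u v w := by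
  rcases lt_or_eq_of_le (unitInterval.le_one' : u ≤ 1) with hu1 | rfl
  · exact hC.eq_copulaFormula_of_lt_one hW ht hu hu1 hv hw
  have hv' : (v : ℝ) < 1 := hv
  have hv0 : (0 : ℝ) ≤ v := v.2.1
  have hw1 : (w : ℝ) ≤ 1 := w.2.2
  -- At `u = 1` the value `stdNormalInv 1` is the meaningless default `sInf ∅ = 0`, but the third
  -- branch does not involve `u`. The value is therefore carried over from `a < 1` by the Lipschitz
  -- bound.
  have hconst : ∀ a : I, 1 + (v : ℝ) < 2 * a → copulaFormula a v w = copulaFormula (1 : I) v w := by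
    intro a ha
    have h1 : (1 : ℝ) + v < 2 * (1 : I) := by
      rw [Icc.coe_one]; linarith
    unfold copulaFormula
    rw [if_neg (by linarith), if_neg (by linarith), if_neg (by linarith), if_neg (by linarith)]
  by_contra hne
  have hδ := abs_pos.2 (sub_ne_zero.2 hne)
  set δ := |(C ![1, v, w] : ℝ) - copulaFormula (1 : I) v w|
  obtain ⟨a, ha1, ha2⟩ := exists_between (max_lt (show (1 + (v : ℝ)) / 2 < 1 by linarith)
    (show 1 - δ < 1 by linarith))
  rw [max_lt_iff] at ha1
  have ha0 : 0 < a := by linarith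
  have h1 := hC.eq_copulaFormula_of_lt_one hW ht (u := ⟨a, ha0.le, ha2.le⟩) ha0 ha2 hv hw
  rw [hconst _ (show 1 + (v : ℝ) < 2 * a by linarith)] at h1
  have h2 := hC.1.three_lipschitz_zero (show (⟨a, ha0.le, ha2.le⟩ : I) ≤ 1 from ha2.le) v w
  rw [h1] at h2
  have h3 : δ ≤ 1 - a := h2
  linarith

end

theorem theorem2 {Ω : Type*} [MeasurableSpace Ω] (P : Measure Ω) [IsProbabilityMeasure P]
    (W : ℝ≥0 → Ω → ℝ) (hW : IsBrownianReal W P) :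
    ∃ C : (Fin 3 → I) → I,
      -- for every `t > 0`, `C` is the one and only copula of `(W_t, M_t, m_t)`
      (∀ t : ℝ≥0, 0 < t → ∀ C' : (Fin 3 → I) → I,
        IsCopulaOf P (tripleAt W t) C' ↔ C' = C) ∧
      -- the series converge and the formula holds wherever it involves finite quantiles only
      (∀ u v w : I, 0 < u → v < 1 → 0 < w →
        (∀ q : ℝ, Summable (psiTerm q (paramR v) (paramS v w))) ∧
        (C ![u, v, w] : ℝ) = copulaFormula u v w) ∧
      -- on the whole closed cube, `C` is the limit of the formula from the open cube
      (∀ p : Fin 3 → I,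
        Tendsto (fun x : Fin 3 → ℝ => copulaFormula (x 0) (x 1) (x 2))
          (𝓝[{x | ∀ i, x i ∈ Ioo (0 : ℝ) 1}] (fun i => (p i : ℝ))) (𝓝 (C p : ℝ))) ∧
      -- `C` arises by substituting the marginal quantile functions
      (∀ t : ℝ≥0, 0 < t → ∀ p : Fin 3 → I, (∀ i, 0 < p i ∧ p i < 1) →
        (C p : ℝ) = jointCDF P (tripleAt W t)
          (fun i => quantileFn P (tripleAt W t i) (p i))) := by
  have hm := fun t => aemeasurable_tripleAt hW t
  have hc := fun (t : ℝ≥0) (ht : 0 < t) => continuous_marginCDF_tripleAt hW ht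
  have hvec : ∀ a : Fin 3 → I, a = ![a 0, a 1, a 2] := fun a => by ext i; fin_cases i <;> rfl
  obtain ⟨C, hC⟩ := exists_isCopulaOf (hm 1) (hc 1 one_pos)
  -- The formula is free of `t`, so the copulas at times `t` and `1` agree in the open cube and
  -- hence everywhere.
  have hall : ∀ t : ℝ≥0, 0 < t → IsCopulaOf P (tripleAt W t) C := fun t ht => by
    obtain ⟨C', hC'⟩ := exists_isCopulaOf (hm t) (hc t ht)
    have : C' = C := hC'.1.eq_of_eqOn hC.1 fun a ha => by
      rw [hvec a]
      exact Subtype.ext ((hC'.eq_copulaFormula hW ht (ha 0).1 (ha 1).2 (ha 2).1).trans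
        (hC.eq_copulaFormula hW one_pos (ha 0).1 (ha 1).2 (ha 2).1).symm)
    exact this ▸ hC'
  refine ⟨C, fun t ht C' => ⟨fun h => h.unique (hm t) (hc t ht) (hall t ht), fun h => h ▸ hall t ht⟩,
    fun u v w hu hv hw => ⟨fun q => ?_, hC.eq_copulaFormula hW one_pos hu hv hw⟩, fun p => ?_,
    fun t ht p hp => ?_⟩
  · have hy := zero_le_stdNormalInv v.2.1 hv
    have hz := stdNormalInv_le_zero hw w.2.2
    unfold paramR paramS
    exact summable_psiTerm (by linarith) (by linarith) q
  -- Projecting onto the cube extends `C` to a continuous function on all of `ℝ³`, whose limit at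
  -- `p` is `C p`.
  · have hg : Continuous fun x : Fin 3 → ℝ => fun i => projIcc (0 : ℝ) 1 zero_le_one (x i) := by
      fun_prop
    have hlim := ((hC.1.continuous_coe.comp hg).tendsto fun i => (p i : ℝ)).mono_left
      (nhdsWithin_le_nhds (s := {x | ∀ i, x i ∈ Ioo (0 : ℝ) 1}))
    have hp : (fun i => projIcc (0 : ℝ) 1 zero_le_one (p i : ℝ)) = p :=
      funext fun i => projIcc_val _ _
    simp only [Function.comp_apply, hp] at hlim
    refine hlim.congr' ?_
    filter_upwards [self_mem_nhdsWithin] with x hx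
    have hx' : ∀ i, projIcc (0 : ℝ) 1 zero_le_one (x i) = ⟨x i, (hx i).1.le, (hx i).2.le⟩ :=
      fun i => projIcc_of_mem _ _
    simp only [Function.comp_apply, hx']
    rw [hvec fun i => (⟨x i, (hx i).1.le, (hx i).2.le⟩ : I)]
    exact hC.eq_copulaFormula hW one_pos (hx 0).1 (hx 1).2 (hx 2).1
  · rw [(hall t ht).2]
    congr 2
    exact funext fun i => (marginCDF_quantileFn (hm t i) (hc t ht i) (hp i).1 (hp i).2).symm
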